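/- For a finite connected graph $G$ with at least one edge, let $\mathsf{g}(G)$ be its (orientable) genus, i.e. the minimum $h$ such that $G$ has a 2-cell embedding in the orientable closed surface $\mathbb{S}_h$ of genus $h$, and let $\widetilde{\mathsf{g}}(G)$ be its non-orientable genus, i.e. the minimum $c$ such that $G$ has a 2-cell embedding in the non-orientable closed surface $\mathbb{N}_c$ with $c$ crosscaps, with the convention $\widetilde{\mathsf{g}}(G)=0$ if $G$ is planar. Here 2-cell embeddings are described combinatorially by embedding schemes $(\pi,\lambda)$: $\pi$ assigns to every vertex a cyclic permutation of its neighbours, and $\lambda$ assigns a sign $\pm1$ to every edge. The faces are the facial walks of the scheme, traced by the usual rule and taken up to cyclic shift and reversal; the surface has Euler characteristic $|V(G)|-|E(G)|+|F|$, where $F$ is the set of faces, and it is orientable if and only if reversing the rotations at some set of vertices (which changes the sign of exactly those edges with one end in the set) makes all signs positive. The genus and the non-orientable genus of a hypergraph $H$ are those of its Levi graph, the bipartite graph on $V(H)\sqcup E(H)$ in which $v\in V(H)$ and $e\in E(H)$ are adjacent if and only if $v$ and $e$ are incident in $H$. Let $mK_n^3$ be the $3$-uniform hypergraph on $n$ vertices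 in which each triple of vertices is the vertex set of exactly $m$ edges. **Theorem.** For every positive integer $m$ and every even integer $n\ge 4$, $$\mathsf{g}(mK_n^3)=\frac{(n-2)(mn(n-1)-12)}{24}\qquad\text{and}\qquad \widetilde{\mathsf{g}}(mK_n^3)=\frac{(n-2)(mn(n-1)-12)}{12}.$$ -/

import Mathlib

namespace HypergraphGenus

/-- An embedding scheme `(π, λ)` of a graph `G`: a local rotation at every vertex, that is, a cyclic
permutation of its neighbours, and a signature `λ : E(G) → {1, -1}`. Up to switching equivalence,
the embedding schemes of a connected graph with at least one edge are exactly its 2-cell embeddings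
in closed surfaces, up to homeomorphism. -/
structure EmbeddingScheme {V : Type*} (G : SimpleGraph V) where
  /-- the local rotation `π_v` -/
  rot : ∀ v : V, Equiv.Perm (G.neighborSet v)
  /-- each local rotation is a single cycle through all the neighbours -/
  rot_cyclic : ∀ v : V, (rot v).IsCycleOn Set.univ
  /-- the signature `λ` -/
  sign : G.edgeSet → ℤˣ

namespace EmbeddingScheme

variable {V : Type*} {G : SimpleGraph V} (Φ : EmbeddingScheme G)

/-- The signature of the edge underlying a dart (a directed edge). -/
def dartSign (d : G.Dart) : ℤˣ := Φ.sign ⟨d.edge, d.edge_mem⟩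

/-- One step of face tracing. The state `(d, ε)` means that the dart `d` is being traversed, and
that the local rotation at the tail of `d` is read clockwise if `ε = 1` and anticlockwise if
`ε = -1`. The mode `ε` is switched by an edge of negative signature; at the head `w` of `d` the
walk goes on along the edge that follows (`ε = 1`) or precedes (`ε = -1`) the edge of `d` in the
local rotation at `w`. -/
def next (s : G.Dart × ℤˣ) : G.Dart × ℤˣ :=
  let ε : ℤˣ := s.2 * Φ.dartSign s.1
  let u : G.neighborSet s.1.snd :=
    ((Φ.rot s.1.snd) ^ (ε : ℤ)) ⟨s.1.fst, s.1.adj.symm⟩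
  (⟨(s.1.snd, (u : V)), u.2⟩, ε)

/-- The state of the same facial walk at the same edge, the walk being traversed backwards. -/
def reverse (s : G.Dart × ℤˣ) : G.Dart × ℤˣ :=
  (s.1.symm, -(s.2 * Φ.dartSign s.1))

/-- The faces: facial walks, i.e. closed walks obtained by face tracing, where a walk is identified
with its cyclic shifts and with its reverse. -/
def Face : Type _ :=
  Quot fun s t : G.Dart × ℤˣ => t = Φ.next s ∨ t = Φ.reverse s

/-- The Euler characteristic `|V| - |E| + |F|` of the surface of the embedding (for a finite
connected graph with at least one edge). -/
noncomputable def eulerChar : ℤ :=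
  (Nat.card V : ℤ) - (Nat.card G.edgeSet : ℤ) + (Nat.card Φ.Face : ℤ)

/-- The embedding is orientable: reversing the local rotations at a suitable set of vertices
(those with `σ v = -1`), which multiplies the signature of `uv` by `σ u * σ v`, makes the
signature trivial. -/
def IsOrientable : Prop :=
  ∃ σ : V → ℤˣ, ∀ d : G.Dart, σ d.fst * Φ.dartSign d * σ d.snd = 1

end EmbeddingScheme

/-- `G` has a 2-cell embedding in the orientable surface `𝕊_h` of genus `h`. -/
def EmbedsInOrientable {V : Type*} (G : SimpleGraph V) (h : ℕ) : Prop :=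
  ∃ Φ : EmbeddingScheme G, Φ.IsOrientable ∧ Φ.eulerChar = 2 - 2 * (h : ℤ)

/-- `G` has a 2-cell embedding in the non-orientable surface `ℕ_c` with `c` crosscaps. -/
def EmbedsInNonorientable {V : Type*} (G : SimpleGraph V) (c : ℕ) : Prop :=
  ∃ Φ : EmbeddingScheme G, ¬ Φ.IsOrientable ∧ Φ.eulerChar = 2 - (c : ℤ)

/-- The (orientable) genus of a graph (finite, connected, with at least one edge): the least `h`
such that `G` has a 2-cell embedding in `𝕊_h` (`⊤` if there were none). -/
noncomputable def graphGenus {V : Type*} (G : SimpleGraph V) : ℕ∞ :=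
  ⨅ (h : ℕ) (_ : EmbedsInOrientable G h), (h : ℕ∞)

open Classical in
/-- The non-orientable genus of a graph (finite, connected, with at least one edge): `0` if `G` is
planar, and otherwise the least `c` such that `G` has a 2-cell embedding in the non-orientable
surface with `c` crosscaps (`⊤` if there were none). -/
noncomputable def graphNonorientableGenus {V : Type*} (G : SimpleGraph V) : ℕ∞ :=
  if EmbedsInOrientable G 0 then 0
  else ⨅ (c : ℕ) (_ : EmbedsInNonorientable G c), (c : ℕ∞)

/-- A hypergraph with vertex set `V` and edge set `E`; distinct edges may have the same set of
vertices. -/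
structure MultiHypergraph (V E : Type*) where
  /-- the set of vertices incident with an edge -/
  verts : E → Finset V

namespace MultiHypergraph

variable {V E : Type*} (H : MultiHypergraph V E)

/-- The Levi graph of `H`: the bipartite graph on `V ⊔ E` in which `v` and `e` are adjacent if and
only if they are incident. -/
def leviGraph : SimpleGraph (V ⊕ E) :=
  SimpleGraph.fromRel fun x y => ∃ v e, x = Sum.inl v ∧ y = Sum.inr e ∧ v ∈ H.verts e

theorem leviGraph_adj_inl_inr (v : V) (e : E) :
    H.leviGraph.Adj (Sum.inl v) (Sum.inr e) ↔ v ∈ H.verts e := by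
  simp [leviGraph]

theorem leviGraph_not_adj_inl_inl (v w : V) :
    ¬ H.leviGraph.Adj (Sum.inl v) (Sum.inl w) := by
  simp [leviGraph]

theorem leviGraph_not_adj_inr_inr (e f : E) :
    ¬ H.leviGraph.Adj (Sum.inr e) (Sum.inr f) := by
  simp [leviGraph]

/-- The (orientable) genus of a hypergraph is that of its Levi graph. -/
noncomputable def genus : ℕ∞ := graphGenus H.leviGraph

/-- The non-orientable genus of a hypergraph is that of its Levi graph. -/
noncomputable def nonorientableGenus : ℕ∞ := graphNonorientableGenus H.leviGraph

end MultiHypergraph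

/-- The hypergraph `mK_n^3` on `n` vertices: each triple of vertices is the vertex set of exactly
`m` edges. -/
def multiComplete (m n : ℕ) :
    MultiHypergraph (Fin n) ({t : Finset (Fin n) // t.card = 3} × Fin m) where
  verts e := e.1.1

end HypergraphGenus

/-! Lower bound: the Levi graph is bipartite and has no vertices of degree one, so every face has
length at least four and `2|F| ≤ |E|`. With `n = 2N` and `(2N).choose 3 = 4D` this gives Euler
characteristic at most `2 - 2g`, where `g = mD + 1 - N`, with equality when all faces are
quadrangles (`eulerChar_le`, `eulerChar_of_quad`). It remains to find quadrangular embeddings of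
both kinds.

Identify the vertices with `K × Bool`, where `|K| = N`. The triples lying over two elements of `K`
are the four faces of a tetrahedron, and those over three elements are the eight faces of an
octahedron; there are `m` copies of each. The Levi graph of the faces of such a sphere is embedded
in it with one quadrangle `v e u f` for each edge `vu`, where `e` and `f` are the two triangles on
`vu`. Given several spheres with the edge `vu`, their quadrangles can be cut open and the halves
recombined cyclically: all faces stay quadrangles (`quadCorner_vertexRot`), while the cycles around
`v`, one per sphere, are spliced into one, and likewise around `u`.

The gluing pattern must leave a single cycle at every vertex (`vertexRot_sameCycle`). All tetrahedra
at `v` are glued along the edge from `v` to `bar v`, and each octahedron at `v` is glued, along its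
one matching edge there, to the central copy of a tetrahedron. So at `v` the spheres and the gluings
form a tree, and no splice undoes another.

A coherent orientation of the spheres makes the result orientable. For a non-orientable embedding,
one sphere whose glued edges form a matching is reversed at the two ends of one of these edges only;
quadrangles survive, but a one-sided closed walk appears. Such a sphere exists unless `m = 1` and `n
= 4`, the planar case, which the convention settles. -/

namespace HypergraphGenus

/-! ### Face tracing and the number of faces. -/

namespace EmbeddingScheme

variable {V : Type*} {G : SimpleGraph V} (Φ : EmbeddingScheme G)

theorem dartSign_symm (d : G.Dart) : Φ.dartSign d.symm = Φ.dartSign d := by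
  simp [dartSign]

theorem reverse_fst (s : G.Dart × ℤˣ) : (Φ.reverse s).1 = s.1.symm := rfl

theorem reverse_reverse (s : G.Dart × ℤˣ) : Φ.reverse (Φ.reverse s) = s := by
  rcases s with ⟨d, ε⟩
  simp [reverse, dartSign_symm, mul_assoc]

/-- Face tracing commutes with reversal up to inversion. -/
theorem next_reverse_next (s : G.Dart × ℤˣ) :
    Φ.next (Φ.reverse (Φ.next s)) = Φ.reverse s := by
  rcases s with ⟨⟨⟨a, b⟩, hab⟩, ε⟩
  have key : ∀ (η : ℤˣ) (x : G.neighborSet b),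
      (Φ.rot b ^ ((-η : ℤˣ) : ℤ)) ((Φ.rot b ^ ((η : ℤˣ) : ℤ)) x) = x := by
    intro η x
    rw [← Equiv.Perm.mul_apply, ← zpow_add]
    simp
  set η : ℤˣ := ε * Φ.dartSign ⟨(a, b), hab⟩ with hη
  set c := (Φ.rot b ^ ((η : ℤˣ) : ℤ)) ⟨a, hab.symm⟩ with hc
  have h1 : Φ.next (⟨(a, b), hab⟩, ε) = (⟨(b, (c : V)), c.2⟩, η) := rfl
  rw [h1]
  have h2 : Φ.reverse (⟨(b, (c : V)), c.2⟩, η) =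
      ((⟨(b, (c : V)), c.2⟩ : G.Dart).symm, -(η * Φ.dartSign ⟨(b, (c : V)), c.2⟩)) := rfl
  rw [h2]
  have h3 : -(η * Φ.dartSign ⟨(b, (c : V)), c.2⟩) *
      Φ.dartSign ((⟨(b, (c : V)), c.2⟩ : G.Dart).symm) = -η := by
    rw [dartSign_symm, neg_mul, mul_assoc]
    simp
  unfold next reverse
  simp only [h3]
  have := key η ⟨a, hab.symm⟩
  rw [← hc] at this
  refine Prod.ext ?_ ?_
  · apply SimpleGraph.Dart.ext
    refine Prod.ext rfl ?_
    exact congrArg Subtype.val this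
  · simp [hη]

theorem next_of_mode_one {a b c : V} (hab : G.Adj a b) (hbc : G.Adj b c) (ε : ℤˣ)
    (hε : ε * Φ.dartSign ⟨(a, b), hab⟩ = 1)
    (hc : Φ.rot b ⟨a, hab.symm⟩ = ⟨c, hbc⟩) :
    Φ.next (⟨(a, b), hab⟩, ε) = (⟨(b, c), hbc⟩, 1) := by
  unfold next
  refine Prod.ext ?_ hε
  apply SimpleGraph.Dart.ext
  refine Prod.ext rfl ?_
  simp [hε, hc]

theorem next_of_mode_neg_one {a b c : V} (hab : G.Adj a b) (hbc : G.Adj b c) (ε : ℤˣ)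
    (hε : ε * Φ.dartSign ⟨(a, b), hab⟩ = -1)
    (hc : Φ.rot b ⟨c, hbc⟩ = ⟨a, hab.symm⟩) :
    Φ.next (⟨(a, b), hab⟩, ε) = (⟨(b, c), hbc⟩, -1) := by
  unfold next
  refine Prod.ext ?_ hε
  apply SimpleGraph.Dart.ext
  refine Prod.ext rfl ?_
  simp [hε, ← hc]

/-- The face that contains a state. -/
def toFace (s : G.Dart × ℤˣ) : Φ.Face := Quot.mk _ s

theorem toFace_surjective : Function.Surjective Φ.toFace := Quot.mk_surjective

theorem toFace_next (s : G.Dart × ℤˣ) : Φ.toFace (Φ.next s) = Φ.toFace s :=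
  (Quot.sound (r := fun s t => t = Φ.next s ∨ t = Φ.reverse s) (Or.inl rfl)).symm

theorem toFace_reverse (s : G.Dart × ℤˣ) : Φ.toFace (Φ.reverse s) = Φ.toFace s :=
  (Quot.sound (r := fun s t => t = Φ.next s ∨ t = Φ.reverse s) (Or.inr rfl)).symm

/-- The invariance is an equivalence in each case, so `p` descends to the quotient. This bounds a
face from above: it lies in any set of states stable under both moves. -/
theorem toFace_rec {p : G.Dart × ℤˣ → Prop} (hn : ∀ t, p (Φ.next t) ↔ p t)
    (hr : ∀ t, p (Φ.reverse t) ↔ p t) {s t : G.Dart × ℤˣ} (h : Φ.toFace t = Φ.toFace s)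
    (hs : p s) : p t := by
  let P : Φ.Face → Prop := Quot.lift p (by
    rintro a b (rfl | rfl)
    · exact propext (hn a).symm
    · exact propext (hr a).symm)
  have h1 : P (Φ.toFace s) := hs
  rw [← h] at h1
  exact h1


/-- The number of states of face tracing is four times the number of edges. -/
theorem card_states [Fintype V] : Nat.card (G.Dart × ℤˣ) = 4 * Nat.card G.edgeSet := by
  classical
  rw [Nat.card_eq_fintype_card, Fintype.card_prod, G.dart_card_eq_twice_card_edges,
    Nat.card_eq_fintype_card, ← SimpleGraph.edgeFinset_card]
  simp
  ring

/-- A facial walk backtracks only where the rotation has a fixed point. -/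
theorem next_snd_ne (hfix : ∀ v x, Φ.rot v x ≠ x) (s : G.Dart × ℤˣ) :
    (Φ.next s).1.snd ≠ s.1.fst := by
  rcases s with ⟨⟨⟨a, b⟩, hab⟩, ε⟩
  intro h
  have h' : (Φ.rot b ^ ((ε * Φ.dartSign ⟨(a, b), hab⟩ : ℤˣ) : ℤ)) ⟨a, hab.symm⟩
      = ⟨a, hab.symm⟩ := Subtype.ext h
  rcases Int.units_eq_one_or (ε * Φ.dartSign ⟨(a, b), hab⟩) with h1 | h1
  · rw [h1] at h'
    exact hfix _ _ (by simpa using h')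
  · rw [h1] at h'
    refine hfix b ⟨a, hab.symm⟩ ?_
    have h2 : (Φ.rot b)⁻¹ ⟨a, hab.symm⟩ = ⟨a, hab.symm⟩ := by simpa using h'
    exact (Equiv.Perm.inv_eq_iff_eq.1 h2).symm

/-- In a bipartite graph without vertices of degree one every face has length at least four. -/
theorem card_face_le [Fintype V] (col : V → Bool) (hcol : ∀ a b, G.Adj a b → col a ≠ col b)
    (hfix : ∀ v x, Φ.rot v x ≠ x) :
    8 * Nat.card Φ.Face ≤ 4 * Nat.card G.edgeSet := by
  classical
  rw [← card_states]
  have : Finite Φ.Face := Finite.of_surjective _ Φ.toFace_surjective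
  have := Fintype.ofFinite Φ.Face
  rw [Nat.card_eq_fintype_card, Nat.card_eq_fintype_card, ← Finset.card_univ (α := G.Dart × ℤˣ),
    Finset.card_eq_sum_card_fiberwise (f := Φ.toFace) (t := Finset.univ) (fun _ _ => by simp)]
  rw [mul_comm, ← Finset.card_univ, ← smul_eq_mul]
  apply Finset.card_nsmul_le_sum
  intro φ _
  obtain ⟨s, rfl⟩ := Φ.toFace_surjective φ
  set s1 := Φ.next s with hs1
  set s2 := Φ.next s1 with hs2
  set s3 := Φ.next s2 with hs3
  let l : List (G.Dart × ℤˣ) :=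
    [s, s1, s2, s3, Φ.reverse s, Φ.reverse s1, Φ.reverse s2, Φ.reverse s3]
  have hl : l.Nodup := by
    -- The eight states already have different darts: the 2-colouring separates vertices at odd
    -- distance along the walk, and the absence of backtracking separates those two steps apart.
    apply List.Nodup.of_map (fun t : G.Dart × ℤˣ => (t.1.fst, t.1.snd))
    have e1 : s1.1.fst = s.1.snd := rfl
    have e2 : s2.1.fst = s1.1.snd := rfl
    have e3 : s3.1.fst = s2.1.snd := rfl
    have n1 : s1.1.snd ≠ s.1.fst := Φ.next_snd_ne hfix s
    have n2 : s2.1.snd ≠ s1.1.fst := Φ.next_snd_ne hfix s1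
    have n3 : s3.1.snd ≠ s2.1.fst := Φ.next_snd_ne hfix s2
    have c0 := hcol _ _ s.1.adj
    have c1 := hcol _ _ s1.1.adj
    have c2 := hcol _ _ s2.1.adj
    have c3 := hcol _ _ s3.1.adj
    simp only [l, List.map_cons, List.map_nil, reverse_fst, SimpleGraph.Dart.symm]
    generalize s.1.toProd = p0 at *
    generalize s1.1.toProd = p1 at *
    generalize s2.1.toProd = p2 at *
    generalize s3.1.toProd = p3 at *
    rcases p0 with ⟨a, b⟩
    rcases p1 with ⟨a1, b1⟩
    rcases p2 with ⟨a2, b2⟩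
    rcases p3 with ⟨a3, b3⟩
    simp only [Prod.swap_prod_mk, List.nodup_cons, List.mem_cons, Prod.mk.injEq, List.not_mem_nil,
      or_false, not_or] at *
    subst e1 e2 e3
    have bne : ∀ {p q r : Bool}, p ≠ q → q ≠ r → r = p := by decide
    have d0 : col a2 = col a := bne c0 c1
    have d1 : col a3 = col a1 := bne c1 c2
    have d2 : col b3 = col a2 := bne c2 c3
    have m0 : a ≠ a1 := fun h => c0 (by rw [h])
    have m1 : a1 ≠ a2 := fun h => c1 (by rw [h])
    have m2 : a2 ≠ a3 := fun h => c2 (by rw [h])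
    have m3 : a3 ≠ b3 := fun h => c3 (by rw [h])
    have m4 : a ≠ a3 := fun h => c0 (by rw [h, d1])
    have m5 : a1 ≠ b3 := fun h => c1 (by rw [h, d2])
    simp [n1, n2, n3, m0, m1, m2, m3, m4, m5, n1.symm, n2.symm, n3.symm, m0.symm, m1.symm,
      m2.symm, m3.symm, m4.symm, m5.symm]
  calc 8 = l.toFinset.card := by rw [List.toFinset_card_of_nodup hl]; rfl
    _ ≤ _ := by
      apply Finset.card_le_card
      intro t ht
      simp only [l, List.mem_toFinset, List.mem_cons, List.not_mem_nil, or_false] at ht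
      simp only [Finset.mem_filter, Finset.mem_univ, true_and]
      rcases ht with rfl | rfl | rfl | rfl | rfl | rfl | rfl | rfl <;> 
        simp [toFace_next, toFace_reverse, s3, s2, s1]

/-- If all facial walks close up after four steps, all faces are quadrangles. -/
theorem le_card_face [Fintype V] (h4 : ∀ s, Φ.next (Φ.next (Φ.next (Φ.next s))) = s) :
    4 * Nat.card G.edgeSet ≤ 8 * Nat.card Φ.Face := by
  classical
  rw [← card_states]
  have : Finite Φ.Face := Finite.of_surjective _ Φ.toFace_surjective
  have := Fintype.ofFinite Φ.Face
  rw [Nat.card_eq_fintype_card, Nat.card_eq_fintype_card, ← Finset.card_univ (α := G.Dart × ℤˣ),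
    Finset.card_eq_sum_card_fiberwise (f := Φ.toFace) (t := Finset.univ) (fun _ _ => by simp)]
  rw [mul_comm 8, ← Finset.card_univ, ← smul_eq_mul]
  apply Finset.sum_le_card_nsmul
  intro φ _
  obtain ⟨s, rfl⟩ := Φ.toFace_surjective φ
  set s1 := Φ.next s with hs1
  set s2 := Φ.next s1 with hs2
  set s3 := Φ.next s2 with hs3
  have hs0 : Φ.next s3 = s := h4 s
  have r1 : Φ.next (Φ.reverse s1) = Φ.reverse s := Φ.next_reverse_next s
  have r2 : Φ.next (Φ.reverse s2) = Φ.reverse s1 := Φ.next_reverse_next s1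
  have r3 : Φ.next (Φ.reverse s3) = Φ.reverse s2 := Φ.next_reverse_next s2
  have r0 : Φ.next (Φ.reverse s) = Φ.reverse s3 := by
    have := Φ.next_reverse_next s3
    rwa [hs0] at this
  let l : List (G.Dart × ℤˣ) :=
    [s, s1, s2, s3, Φ.reverse s, Φ.reverse s1, Φ.reverse s2, Φ.reverse s3]
  have hnext : ∀ t ∈ l, Φ.next t ∈ l := by
    intro t ht
    simp only [l, List.mem_cons, List.not_mem_nil, or_false] at ht ⊢
    rcases ht with rfl | rfl | rfl | rfl | rfl | rfl | rfl | rfl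
    · simp [hs1]
    · simp [hs2]
    · simp [hs3]
    · simp [hs0]
    · simp [r0]
    · simp [r1]
    · simp [r2]
    · simp [r3]
  have hrev : ∀ t ∈ l, Φ.reverse t ∈ l := by
    intro t ht
    simp only [l, List.mem_cons, List.not_mem_nil, or_false] at ht ⊢
    rcases ht with rfl | rfl | rfl | rfl | rfl | rfl | rfl | rfl <;> simp [reverse_reverse]
  have hmem : ∀ t, Φ.toFace t = Φ.toFace s → t ∈ l := by
    intro t ht
    refine Φ.toFace_rec (p := fun t => t ∈ l) (fun a => ⟨fun h => ?_, hnext a⟩)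
      (fun a => ⟨fun h => ?_, hrev a⟩) ht (by simp [l])
    · rw [← h4 a]
      exact hnext _ (hnext _ (hnext _ h))
    · rw [← Φ.reverse_reverse a]
      exact hrev _ h
  calc _ ≤ l.toFinset.card := by
        apply Finset.card_le_card
        intro t ht
        simp only [Finset.mem_filter, Finset.mem_univ, true_and] at ht
        exact List.mem_toFinset.2 (hmem t ht)
    _ ≤ l.length := l.toFinset_card_le
    _ = 8 := rfl

end EmbeddingScheme

/-! ### Quadrangular schemes on Levi graphs. -/

namespace EmbeddingScheme

variable {V : Type*} {G : SimpleGraph V} (Φ : EmbeddingScheme G)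

/-- The facial walk of the state `s` has length (a divisor of) four. -/
def Quad (s : G.Dart × ℤˣ) : Prop := Φ.next (Φ.next (Φ.next (Φ.next s))) = s

variable {Φ}

theorem Quad.next {s : G.Dart × ℤˣ} (h : Φ.Quad s) : Φ.Quad (Φ.next s) :=
  congrArg Φ.next h

theorem Quad.reverse {s : G.Dart × ℤˣ} (h : Φ.Quad s) : Φ.Quad (Φ.reverse s) := by
  have r1 := Φ.next_reverse_next s
  have r2 := Φ.next_reverse_next (Φ.next s)
  have r3 := Φ.next_reverse_next (Φ.next (Φ.next s))
  have r4 := Φ.next_reverse_next (Φ.next (Φ.next (Φ.next s)))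
  unfold Quad at h ⊢
  rw [h] at r4
  rw [r4, r3, r2, r1]

end EmbeddingScheme

theorem sameCycle_permCongr {α β : Type*} (e : α ≃ β) (p : Equiv.Perm α)
    (h : ∀ x y, p.SameCycle x y) (x y : β) : (e.permCongr p).SameCycle x y := by
  obtain ⟨i, hi⟩ := h (e.symm x) (e.symm y)
  refine ⟨i, ?_⟩
  have : (e.permCongr p) ^ i = e.permCongr (p ^ i) := (map_zpow e.permCongrHom p i).symm
  rw [this, Equiv.permCongr_apply, hi, Equiv.apply_symm_apply]

theorem isCycleOn_univ {α : Type*} (p : Equiv.Perm α) (h : ∀ x y, p.SameCycle x y) :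
    p.IsCycleOn Set.univ :=
  ⟨Set.bijOn_univ.2 p.bijective, fun x _ y _ => h x y⟩

namespace MultiHypergraph

variable {V E : Type*} (H : MultiHypergraph V E)

theorem leviGraph_adj_inr_inl (v : V) (e : E) :
    H.leviGraph.Adj (Sum.inr e) (Sum.inl v) ↔ v ∈ H.verts e := by
  rw [SimpleGraph.adj_comm, leviGraph_adj_inl_inr]

/-- The neighbours of a vertex in the Levi graph are the edges through it. -/
def inlNeighbors (v : V) :
    {e // v ∈ H.verts e} ≃ H.leviGraph.neighborSet (Sum.inl v) where
  toFun e := ⟨Sum.inr e.1, (H.leviGraph_adj_inl_inr v e.1).2 e.2⟩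
  invFun x := match x with
    | ⟨Sum.inl w, h⟩ => (H.leviGraph_not_adj_inl_inl v w h).elim
    | ⟨Sum.inr e, h⟩ => ⟨e, (H.leviGraph_adj_inl_inr v e).1 h⟩
  left_inv _ := rfl
  right_inv x := match x with
    | ⟨Sum.inl w, h⟩ => (H.leviGraph_not_adj_inl_inl v w h).elim
    | ⟨Sum.inr _, _⟩ => rfl

/-- The neighbours of an edge in the Levi graph are the vertices on it. -/
def inrNeighbors (e : E) :
    {v // v ∈ H.verts e} ≃ H.leviGraph.neighborSet (Sum.inr e) where
  toFun v := ⟨Sum.inl v.1, (H.leviGraph_adj_inr_inl v.1 e).2 v.2⟩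
  invFun x := match x with
    | ⟨Sum.inr f, h⟩ => (H.leviGraph_not_adj_inr_inr e f h).elim
    | ⟨Sum.inl v, h⟩ => ⟨v, (H.leviGraph_adj_inr_inl v e).1 h⟩
  left_inv _ := rfl
  right_inv x := match x with
    | ⟨Sum.inr f, h⟩ => (H.leviGraph_not_adj_inr_inr e f h).elim
    | ⟨Sum.inl _, _⟩ => rfl

/-- The signature of the Levi graph given by signs of incident pairs. -/
def leviSign (s : V → E → ℤˣ) : Sym2 (V ⊕ E) → ℤˣ :=
  Sym2.lift ⟨fun x y => match x, y with
    | Sum.inl v, Sum.inr e => s v e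
    | Sum.inr e, Sum.inl v => s v e
    | Sum.inl _, Sum.inl _ => 1
    | Sum.inr _, Sum.inr _ => 1, by
    rintro (x | x) (y | y) <;> rfl⟩

/-- An embedding scheme of the Levi graph from rotations of the edges through every vertex,
rotations of the vertices on every edge and signs of the incident pairs. -/
def leviScheme (ρ : ∀ v, Equiv.Perm {e // v ∈ H.verts e}) (hρ : ∀ v x y, (ρ v).SameCycle x y)
    (α : ∀ e, Equiv.Perm {v // v ∈ H.verts e}) (hα : ∀ e x y, (α e).SameCycle x y)
    (s : V → E → ℤˣ) : EmbeddingScheme H.leviGraph where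
  rot x := match x with
    | Sum.inl v => (H.inlNeighbors v).permCongr (ρ v)
    | Sum.inr e => (H.inrNeighbors e).permCongr (α e)
  rot_cyclic x := match x with
    | Sum.inl v => isCycleOn_univ _ (sameCycle_permCongr _ _ (hρ v))
    | Sum.inr e => isCycleOn_univ _ (sameCycle_permCongr _ _ (hα e))
  sign z := leviSign s z.1

section

variable {H} {ρ : ∀ v, Equiv.Perm {e // v ∈ H.verts e}} {hρ : ∀ v x y, (ρ v).SameCycle x y}
  {α : ∀ e, Equiv.Perm {v // v ∈ H.verts e}} {hα : ∀ e x y, (α e).SameCycle x y}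
  {s : V → E → ℤˣ}

/-- The dart of the Levi graph from a vertex to an edge. -/
def outDart {v : V} {e : E} (h : v ∈ H.verts e) : H.leviGraph.Dart :=
  ⟨(Sum.inl v, Sum.inr e), (H.leviGraph_adj_inl_inr v e).2 h⟩

/-- The dart of the Levi graph from an edge to a vertex. -/
def inDart {v : V} {e : E} (h : v ∈ H.verts e) : H.leviGraph.Dart :=
  ⟨(Sum.inr e, Sum.inl v), (H.leviGraph_adj_inr_inl v e).2 h⟩

theorem leviScheme_next_out {v u : V} {e : E} (hv : v ∈ H.verts e) (hu : u ∈ H.verts e)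
    {ε δ : ℤˣ} (hδ : ε * s v e = δ) (h1 : δ = 1 → α e ⟨v, hv⟩ = ⟨u, hu⟩)
    (h2 : δ = -1 → α e ⟨u, hu⟩ = ⟨v, hv⟩) :
    (H.leviScheme ρ hρ α hα s).next (outDart hv, ε) = (inDart hu, δ) := by
  rcases Int.units_eq_one_or δ with rfl | rfl
  · refine EmbeddingScheme.next_of_mode_one _ _ _ _ hδ ?_
    exact congrArg (H.inrNeighbors e) (h1 rfl)
  · refine EmbeddingScheme.next_of_mode_neg_one _ _ _ _ hδ ?_
    exact congrArg (H.inrNeighbors e) (h2 rfl)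

theorem leviScheme_next_in {v : V} {e f : E} (he : v ∈ H.verts e) (hf : v ∈ H.verts f)
    {ε δ : ℤˣ} (hδ : ε * s v e = δ) (h1 : δ = 1 → ρ v ⟨e, he⟩ = ⟨f, hf⟩)
    (h2 : δ = -1 → ρ v ⟨f, hf⟩ = ⟨e, he⟩) :
    (H.leviScheme ρ hρ α hα s).next (inDart he, ε) = (outDart hf, δ) := by
  rcases Int.units_eq_one_or δ with rfl | rfl
  · refine EmbeddingScheme.next_of_mode_one _ _ _ _ hδ ?_
    exact congrArg (H.inlNeighbors v) (h1 rfl)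
  · refine EmbeddingScheme.next_of_mode_neg_one _ _ _ _ hδ ?_
    exact congrArg (H.inlNeighbors v) (h2 rfl)

/-- The corner at `v` from `e` to `f` is a corner of the quadrangle `v e u f`. -/
structure QuadCorner (ρ : ∀ v, Equiv.Perm {e // v ∈ H.verts e})
    (α : ∀ e, Equiv.Perm {v // v ∈ H.verts e}) (s : V → E → ℤˣ) {v u : V} {e f : E}
    (hve : v ∈ H.verts e) (hvf : v ∈ H.verts f) (hue : u ∈ H.verts e) (huf : u ∈ H.verts f) :
    Prop where
  rot_left_pos : s v e = 1 → α e ⟨u, hue⟩ = ⟨v, hve⟩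
  rot_left_neg : s v e = -1 → α e ⟨v, hve⟩ = ⟨u, hue⟩
  rot_right_pos : s v f = 1 → α f ⟨v, hvf⟩ = ⟨u, huf⟩
  rot_right_neg : s v f = -1 → α f ⟨u, huf⟩ = ⟨v, hvf⟩
  sign_eq : s v e * s u e = s v f * s u f
  rot_opposite_pos : s v e * s u e = 1 → ρ u ⟨f, huf⟩ = ⟨e, hue⟩
  rot_opposite_neg : s v e * s u e = -1 → ρ u ⟨e, hue⟩ = ⟨f, huf⟩

/-- Starting in mode `s v e` makes the mode `1` at `v`. From there the modes at `f`, `u` and `e` are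
`s v f`, `s v f * s u f` and `s v e`, so the fields of `QuadCorner` decide each turn. -/
theorem leviScheme_quad_in {v u : V} {e f : E}
    {hve : v ∈ H.verts e} {hvf : v ∈ H.verts f} {hue : u ∈ H.verts e} {huf : u ∈ H.verts f}
    (hf : ρ v ⟨e, hve⟩ = ⟨f, hvf⟩) (h : QuadCorner ρ α s hve hvf hue huf) :
    (H.leviScheme ρ hρ α hα s).Quad (inDart hve, s v e) := by
  unfold EmbeddingScheme.Quad
  have hne : (1 : ℤˣ) ≠ -1 := by decide
  have sq : ∀ a : ℤˣ, a * a = 1 := Int.units_mul_self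
  rw [leviScheme_next_in hve hvf (sq _) (fun _ => hf) (fun h => absurd h hne),
    leviScheme_next_out hvf huf (one_mul _) h.rot_right_pos h.rot_right_neg,
    leviScheme_next_in huf hue rfl (fun h1 => h.rot_opposite_pos (h.sign_eq.trans h1))
      (fun h1 => h.rot_opposite_neg (h.sign_eq.trans h1)),
    leviScheme_next_out hue hve (δ := s v e) (by rw [← h.sign_eq, mul_assoc, sq, mul_one])
      h.rot_left_pos h.rot_left_neg]

/-- One state per incoming dart suffices: stepping and reversing carry these states to all others.
-/
theorem leviScheme_quad
    (h : ∀ v e f (hve : v ∈ H.verts e) (hvf : v ∈ H.verts f), ρ v ⟨e, hve⟩ = ⟨f, hvf⟩ →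
      ∃ u, ∃ (hue : u ∈ H.verts e) (huf : u ∈ H.verts f), QuadCorner ρ α s hve hvf hue huf)
    (t : H.leviGraph.Dart × ℤˣ) : (H.leviScheme ρ hρ α hα s).Quad t := by
  have sq : ∀ a : ℤˣ, a * a = 1 := Int.units_mul_self
  have hin : ∀ v e (he : v ∈ H.verts e),
      (H.leviScheme ρ hρ α hα s).Quad (inDart he, s v e) := by
    intro v e he
    obtain ⟨u, hue, huf, hc⟩ := h v e _ he (ρ v ⟨e, he⟩).2 rfl
    exact leviScheme_quad_in rfl hc
  have hout : ∀ v e (he : v ∈ H.verts e) (ε : ℤˣ),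
      (H.leviScheme ρ hρ α hα s).Quad (outDart he, ε) := by
    intro v e he ε
    rcases Int.units_eq_one_or ε with rfl | rfl
    · have h1 := (hin v _ ((ρ v).symm ⟨e, he⟩).2).next
      rwa [leviScheme_next_in _ he (sq _) (fun _ => by simp)
        (fun h => absurd h (by decide))] at h1
    · have h1 := (hin v e he).reverse
      have h2 : (H.leviScheme ρ hρ α hα s).reverse (inDart he, s v e) = (outDart he, -1) := by
        refine Prod.ext rfl ?_
        change -(s v e * s v e) = -1
        rw [sq]
      rwa [h2] at h1
  rcases t with ⟨⟨⟨x | x, y | y⟩, hxy⟩, ε⟩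
  · exact (H.leviGraph_not_adj_inl_inl _ _ hxy).elim
  · exact hout x y ((H.leviGraph_adj_inl_inr x y).1 hxy) ε
  · have he := (H.leviGraph_adj_inr_inl y x).1 hxy
    have h1 := (hout y x he (-(ε * s y x))).reverse
    have h2 : (H.leviScheme ρ hρ α hα s).reverse (outDart he, -(ε * s y x)) =
        (⟨(Sum.inr x, Sum.inl y), hxy⟩, ε) := by
      refine Prod.ext rfl ?_
      change -(-(ε * s y x) * s y x) = ε
      rw [neg_mul, neg_neg, mul_assoc, sq, mul_one]
    rwa [h2] at h1
  · exact (H.leviGraph_not_adj_inr_inr _ _ hxy).elim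

end

end MultiHypergraph

/-- If a permutation `p` moves all points but one of an invariant set inside their classes, it does
so for the last point too. -/
theorem rel_apply_of_forall_ne {X : Type*} [Finite X] (p : Equiv.Perm X) {r : X → X → Prop}
    (hr : Equivalence r) (P : X → Prop) (hP : ∀ y, P y → P (p y)) {x : X} (hx : P x)
    (h : ∀ y, P y → y ≠ x → r y (p y)) : r x (p x) := by
  have key : ∀ i : ℕ, P ((p ^ i) (p x)) ∧ (r (p x) ((p ^ i) (p x)) ∨ r x (p x)) := by
    intro i
    induction i with
    | zero => exact ⟨hP x hx, Or.inl (hr.refl _)⟩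
    | succ i ih =>
      obtain ⟨h1, h2⟩ := ih
      rw [pow_succ', Equiv.Perm.mul_apply]
      refine ⟨hP _ h1, ?_⟩
      rcases h2 with h2 | h2
      · by_cases hxi : (p ^ i) (p x) = x
        · rw [hxi] at h2
          exact Or.inr (hr.symm h2)
        · exact Or.inl (hr.trans h2 (h _ h1 hxi))
      · exact Or.inr h2
  -- By finite order, the orbit of `p x` returns to `x` after `n - 1` steps, and until then every
  -- step stays in the class.
  obtain ⟨n, hn, hpn⟩ : ∃ n, 0 < n ∧ p ^ n = 1 := ⟨orderOf p, orderOf_pos p, pow_orderOf_eq_one p⟩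
  obtain ⟨-, h2⟩ := key (n - 1)
  rw [← Equiv.Perm.mul_apply, ← pow_succ, Nat.sub_add_cancel hn, hpn] at h2
  rcases h2 with h2 | h2
  · exact hr.symm h2
  · exact h2

/-! ### Coherent orientations of tetrahedra and octahedra. -/

section Orientation

variable {K : Type*} [LinearOrder K]

/-- The sign of a Boolean. -/
def boolSign (b : Bool) : ℤˣ := if b then 1 else -1

/-- The antisymmetric sign of two distinct elements of a linear order. -/
def ltSign (k l : K) : ℤˣ := if k < l then 1 else -1

theorem ltSign_swap {k l : K} (h : k ≠ l) : ltSign l k = -ltSign k l := by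
  rcases lt_or_gt_of_ne h with h | h <;> simp [ltSign, h, h.not_gt]

theorem boolSign_not (b : Bool) : boolSign (!b) = -boolSign b := by
  cases b <;> rfl

/-- The coherent orientation of the triangles: the triangles whose vertices lie over a given set of
two (three) elements of `K` form the boundary of a tetrahedron (an octahedron), which is oriented
by `orient`. -/
def orient (v w x : K × Bool) : ℤˣ :=
  if v.1 = w.1 then boolSign v.2 * boolSign x.2
  else if w.1 = x.1 then boolSign w.2 * boolSign v.2
  else if x.1 = v.1 then boolSign x.2 * boolSign w.2
  else ltSign v.1 w.1 * ltSign w.1 x.1 * ltSign v.1 x.1 *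
    (boolSign v.2 * boolSign w.2 * boolSign x.2)

variable {v w x y : K × Bool}

theorem eq_not_of_ne {a b : Bool} (h : a ≠ b) : b = !a := by
  revert a b; decide

/-- Together with `orient_swap`, this makes `orient` alternating, so its value selects one of the
two cyclic orders of a triangle. -/
theorem orient_rotate (hvw : v ≠ w) (hvx : v ≠ x) (hwx : w ≠ x) :
    orient w x v = orient v w x := by
  obtain ⟨k, a⟩ := v
  obtain ⟨l, b⟩ := w
  obtain ⟨m, c⟩ := x
  unfold orient
  by_cases h1 : k = l
  · subst h1
    by_cases h2 : k = m
    · subst h2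
      revert hvw hvx hwx
      simp only [ne_eq, Prod.mk.injEq, true_and]
      cases a <;> cases b <;> cases c <;> simp
    · simp [h2, Ne.symm h2]
  · by_cases h2 : l = m
    · subst h2
      simp [h1]
    · by_cases h3 : k = m
      · subst h3
        simp [h1, h2]
      · simp only [h1, h2, Ne.symm h3, if_false]
        rw [ltSign_swap h3, ltSign_swap h1]
        simp only [mul_neg, neg_mul, neg_neg]
        ac_rfl

theorem orient_swap (hvw : v ≠ w) (hvx : v ≠ x) (hwx : w ≠ x) :
    orient w v x = -orient v w x := by
  obtain ⟨k, a⟩ := v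
  obtain ⟨l, b⟩ := w
  obtain ⟨m, c⟩ := x
  unfold orient
  by_cases h1 : k = l
  · subst h1
    have : b = !a := eq_not_of_ne (fun h => hvw (by rw [h]))
    simp [this, boolSign_not]
  · by_cases h2 : l = m
    · subst h2
      have : c = !b := eq_not_of_ne (fun h => hwx (by rw [h]))
      simp [h1, Ne.symm h1, this, boolSign_not]
    · by_cases h3 : k = m
      · subst h3
        have : c = !a := eq_not_of_ne (fun h => hvx (by rw [h]))
        simp [h1, Ne.symm h1, this, boolSign_not, mul_comm]
      · simp only [h1, h2, h3, Ne.symm h1, Ne.symm h2, Ne.symm h3, if_false]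
        rw [ltSign_swap h1]
        simp only [neg_mul]
        congr 1
        ac_rfl

/-- The two triangles of a sphere at an edge induce opposite orientations on it. -/
theorem orient_eq_neg (hvw : v ≠ w) (hvx : v ≠ x) (hwx : w ≠ x) (hvy : v ≠ y) (hwy : w ≠ y)
    (hxy : x ≠ y) (h : ({v.1, w.1, x.1} : Finset K) = {v.1, w.1, y.1}) :
    orient v w y = -orient v w x := by
  have h1 : x.1 ∈ ({v.1, w.1, y.1} : Finset K) := by rw [← h]; simp
  have h2 : y.1 ∈ ({v.1, w.1, x.1} : Finset K) := by rw [h]; simp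
  obtain ⟨k, a⟩ := v
  obtain ⟨l, b⟩ := w
  obtain ⟨m, c⟩ := x
  obtain ⟨n, d⟩ := y
  simp only [Finset.mem_insert, Finset.mem_singleton] at h1 h2
  simp only [ne_eq, Prod.mk.injEq] at hvw hvx hwx hvy hwy hxy
  unfold orient
  dsimp only
  rcases eq_or_ne m n with rfl | hmn
  · have : d = !c := eq_not_of_ne (by tauto)
    subst this
    by_cases g1 : k = l
    · simp [g1, boolSign_not]
    by_cases g2 : l = m
    · subst g2; revert hwx hwy; cases b <;> cases c <;> simp
    by_cases g3 : k = m
    · subst g3; revert hvx hvy; cases a <;> cases c <;> simp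
    simp [g1, g2, Ne.symm g3, boolSign_not]
  · rcases h1 with rfl | rfl | h1
    · rcases h2 with rfl | rfl | h2
      · exact absurd rfl hmn
      · have e1 : c = !a := eq_not_of_ne (by tauto)
        simp [hmn, Ne.symm hmn, e1, boolSign_not, mul_comm]
      · exact absurd h2.symm hmn
    · rcases h2 with rfl | rfl | h2
      · have e1 : d = !a := eq_not_of_ne (by tauto)
        simp [hmn, Ne.symm hmn, e1, boolSign_not, mul_comm]
      · exact absurd rfl hmn
      · exact absurd h2.symm hmn
    · exact absurd h1 hmn

/-- Every edge of a sphere lies in a second triangle. -/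
theorem exists_other (hvw : v ≠ w) (hvx : v ≠ x) (hwx : w ≠ x) :
    ∃ y, v ≠ y ∧ w ≠ y ∧ x ≠ y ∧ ({v.1, w.1, x.1} : Finset K) = {v.1, w.1, y.1} := by
  obtain ⟨k, a⟩ := v
  obtain ⟨l, b⟩ := w
  obtain ⟨m, c⟩ := x
  simp only [ne_eq, Prod.mk.injEq] at hvw hvx hwx
  by_cases g1 : k = m
  · subst g1
    have hkl : k ≠ l := by
      rintro rfl
      revert hvw hvx hwx; simp only [true_and]; revert a b c; decide
    refine ⟨(l, !b), ?_, ?_, ?_, ?_⟩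
    · simp [hkl]
    · simp
    · simp [hkl]
    · ext z; simp; tauto
  · by_cases g2 : l = m
    · subst g2
      refine ⟨(k, !a), ?_, ?_, ?_, ?_⟩
      · simp
      · simp [Ne.symm g1]
      · simp [Ne.symm g1]
      · ext z; simp; tauto
    · exact ⟨(m, !c), by simp [g1], by simp [g2], by simp, rfl⟩

/-- The link of a vertex in a sphere is a cycle of length at most four. -/
theorem mem_link {z u u' : K × Bool} (hvw : v ≠ w) (hvx : v ≠ x) (hwx : w ≠ x)
    (hvy : v ≠ y) (hxy : x ≠ y) (hwy : w ≠ y)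
    (hy : ({v.1, w.1, x.1} : Finset K) = {v.1, x.1, y.1})
    (hvz : v ≠ z) (hyz : y ≠ z) (hxz : x ≠ z)
    (hz : ({v.1, w.1, x.1} : Finset K) = {v.1, y.1, z.1})
    (hvu : v ≠ u) (hvu' : v ≠ u') (huu' : u ≠ u')
    (hu : ({v.1, w.1, x.1} : Finset K) = {v.1, u.1, u'.1}) :
    u = w ∨ u = x ∨ u = y ∨ u = z := by
  obtain ⟨k, a⟩ := v
  obtain ⟨l, b⟩ := w
  obtain ⟨m, c⟩ := x
  obtain ⟨n, d⟩ := y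
  obtain ⟨o, e⟩ := z
  obtain ⟨p, f⟩ := u
  obtain ⟨p', f'⟩ := u'
  simp only [Finset.ext_iff, Finset.mem_insert, Finset.mem_singleton] at hy hz hu
  have y1 := (hy l).1 (by simp)
  have y2 := (hy n).2 (by simp)
  have y3 := (hy m).1 (by simp)
  have z1 := (hz l).1 (by simp)
  have z2 := (hz m).1 (by simp)
  have z3 := (hz o).2 (by simp)
  have u1 := (hu p).2 (by simp)
  have u2 := (hu p').2 (by simp)
  have u3 := (hu l).1 (by simp)
  have u4 := (hu m).1 (by simp)
  clear hy hz hu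
  simp only [ne_eq, Prod.mk.injEq] at *
  by_cases g1 : k = l
  · subst g1
    by_cases g2 : k = m
    · subst g2
      simp only [true_and] at hvw hvx hwx
      exact absurd ((eq_not_of_ne hvw).trans (eq_not_of_ne hvx).symm) hwx
    · cases a <;> cases f <;> grind
  · by_cases g2 : k = m
    · subst g2
      cases a <;> cases f <;> grind
    · by_cases g3 : l = m
      · subst g3
        cases b <;> cases f <;> grind
      · cases b <;> cases c <;> cases f <;> grind

end Orientation

/-- The edges of the hypergraph `mK_n^3`. -/
abbrev Triple (n m : ℕ) : Type := {t : Finset (Fin n) // t.card = 3} × Fin m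

theorem units_neg_eq_of_ne {a b : ℤˣ} (h : a ≠ b) : -a = b := by
  revert a b; decide

/-! ### Triangles of the spheres as oriented triples. -/

section Corner

variable {n m : ℕ} {K : Type*} [LinearOrder K] (q : Fin n ≃ K × Bool)

/-- The sphere to which a triple belongs. -/
def piece (e : Triple n m) : Finset K × Fin m := (e.1.1.image fun v => (q v).1, e.2)

/-- `u` is a neighbour of `v` in the sphere `B`. -/
def PieceEdge (v u : Fin n) (B : Finset K × Fin m) : Prop :=
  ∃ y, v ≠ u ∧ v ≠ y ∧ u ≠ y ∧ B.1 = {(q v).1, (q u).1, (q y).1}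

/-- The triple `e` has vertices `v, w, x`, in the cyclic order given by the orientation of its
sphere, reversed where the sign `s` is negative. -/
structure Corner (s : Fin n → Finset K × Fin m → ℤˣ) (v : Fin n) (e : Triple n m)
    (w x : Fin n) : Prop where
  ne₁ : v ≠ w
  ne₂ : v ≠ x
  ne₃ : w ≠ x
  eq : e.1.1 = {v, w, x}
  orient_eq : orient (q v) (q w) (q x) = s v (piece q e)

variable {q} {s : Fin n → Finset K × Fin m → ℤˣ} {v u w x y : Fin n} {e f : Triple n m}
  {B : Finset K × Fin m}

theorem PieceEdge.symm (h : PieceEdge q v u B) : PieceEdge q u v B := by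
  obtain ⟨y, h1, h2, h3, h4⟩ := h
  exact ⟨y, h1.symm, h3, h2, by rw [h4, Finset.insert_comm]⟩

theorem piece_fst (h : e.1.1 = {v, w, x}) :
    (piece q e).1 = {(q v).1, (q w).1, (q x).1} := by
  simp [piece, h, Finset.image_insert]

namespace Corner

theorem mem (h : Corner q s v e w x) : v ∈ e.1.1 := by rw [h.eq]; simp

theorem mem_out (h : Corner q s v e w x) : w ∈ e.1.1 := by rw [h.eq]; simp

theorem mem_inn (h : Corner q s v e w x) : x ∈ e.1.1 := by rw [h.eq]; simp

theorem piece_eq (h : Corner q s v e w x) :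
    (piece q e).1 = {(q v).1, (q w).1, (q x).1} := piece_fst h.eq

theorem edge_out (h : Corner q s v e w x) : PieceEdge q v w (piece q e) :=
  ⟨x, h.ne₁, h.ne₂, h.ne₃, h.piece_eq⟩

theorem edge_inn (h : Corner q s v e w x) : PieceEdge q v x (piece q e) :=
  ⟨w, h.ne₂, h.ne₁, h.ne₃.symm, by rw [h.piece_eq, Finset.pair_comm]⟩

theorem orient_inn (h : Corner q s v e w x) :
    orient (q x) (q v) (q w) = s v (piece q e) := by
  rw [← h.orient_eq, ← orient_rotate (q.injective.ne h.ne₂.symm) (q.injective.ne h.ne₃.symm)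
    (q.injective.ne h.ne₁)]

theorem orient_out (h : Corner q s v e w x) :
    orient (q w) (q x) (q v) = s v (piece q e) := by
  rw [← h.orient_eq, orient_rotate (q.injective.ne h.ne₁) (q.injective.ne h.ne₂)
    (q.injective.ne h.ne₃)]

theorem orient_swap (h : Corner q s v e w x) :
    orient (q v) (q x) (q w) = -s v (piece q e) := by
  rw [← h.orient_inn, HypergraphGenus.orient_swap (q.injective.ne h.ne₂.symm)
    (q.injective.ne h.ne₃.symm) (q.injective.ne h.ne₁)]

/-- The same triple at the next vertex, where the sign is the same. -/
theorem rotate_out {s' : Fin n → Finset K × Fin m → ℤˣ} (h : Corner q s v e w x)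
    (hs : s' w (piece q e) = s v (piece q e)) : Corner q s' w e x v :=
  ⟨h.ne₃, h.ne₁.symm, h.ne₂.symm, by rw [h.eq]; ext; simp; tauto, by rw [h.orient_out, hs]⟩

theorem rotate_inn {s' : Fin n → Finset K × Fin m → ℤˣ} (h : Corner q s v e w x)
    (hs : s' x (piece q e) = s v (piece q e)) : Corner q s' x e v w :=
  ⟨h.ne₂.symm, h.ne₃.symm, h.ne₁, by rw [h.eq]; ext; simp; tauto, by rw [h.orient_inn, hs]⟩

/-- The same triple and vertex, with the opposite sign. -/
theorem swap {s' : Fin n → Finset K × Fin m → ℤˣ} (h : Corner q s v e w x)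
    (hs : s' v (piece q e) = -s v (piece q e)) : Corner q s' v e x w :=
  ⟨h.ne₂, h.ne₁, h.ne₃.symm, by rw [h.eq, Finset.pair_comm], by rw [h.orient_swap, hs]⟩

theorem congr {s' : Fin n → Finset K × Fin m → ℤˣ} (h : Corner q s v e w x)
    (hs : s' v (piece q e) = s v (piece q e)) : Corner q s' v e w x :=
  ⟨h.ne₁, h.ne₂, h.ne₃, h.eq, by rw [h.orient_eq, hs]⟩

theorem unique (h : Corner q s v e w x) {w' x' : Fin n} (h' : Corner q s v e w' x') :
    w = w' ∧ x = x' := by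
  have hw : w' ∈ ({v, w, x} : Finset (Fin n)) := h.eq ▸ h'.mem_out
  have hx : x' ∈ ({v, w, x} : Finset (Fin n)) := h.eq ▸ h'.mem_inn
  simp only [Finset.mem_insert, Finset.mem_singleton, h'.ne₁.symm, h'.ne₂.symm, false_or] at hw hx
  rcases hw with rfl | rfl <;> rcases hx with rfl | rfl
  · exact absurd rfl h'.ne₃
  · exact ⟨rfl, rfl⟩
  · have h1 := h.orient_swap
    rw [h'.orient_eq] at h1
    rcases Int.units_eq_one_or (s v (piece q e)) with h2 | h2 <;> rw [h2] at h1 <;>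
      exact absurd h1 (by decide)
  · exact absurd rfl h'.ne₃

/-- A triple is determined by its sphere and its edge out of `v`. -/
theorem eq_of_out (hw : Corner q s v e w x) (hf : Corner q s v f w y)
    (hp : piece q e = piece q f) : e = f := by
  by_cases hxy : x = y
  · subst hxy
    refine Prod.ext (Subtype.ext (hw.eq.trans hf.eq.symm)) ?_
    exact congrArg (fun p : Finset K × Fin m => p.2) hp
  · have h1 := orient_eq_neg (q.injective.ne hw.ne₁) (q.injective.ne hw.ne₂)
      (q.injective.ne hw.ne₃) (q.injective.ne hf.ne₂) (q.injective.ne hf.ne₃)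
      (q.injective.ne hxy) (by rw [← hw.piece_eq, ← hf.piece_eq, hp])
    rw [hw.orient_eq, hf.orient_eq, hp] at h1
    rcases Int.units_eq_one_or (s v (piece q f)) with h2 | h2 <;> rw [h2] at h1 <;>
      exact absurd h1 (by decide)

/-- A triple is determined by its sphere and its edge into `v`. -/
theorem eq_of_inn (hw : Corner q s v e w x) (hf : Corner q s v f y x)
    (hp : piece q e = piece q f) : e = f :=
  (hw.swap (s' := fun v B => -s v B) rfl).eq_of_out (hf.swap rfl) hp

end Corner

theorem card_triple (hvw : v ≠ w) (hvx : v ≠ x) (hwx : w ≠ x) :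
    ({v, w, x} : Finset (Fin n)).card = 3 := Finset.card_eq_three.2 ⟨v, w, x, hvw, hvx, hwx, rfl⟩

theorem exists_corner_of_orient (hvw : v ≠ w) (hvx : v ≠ x) (hwx : w ≠ x)
    (hB : B.1 = {(q v).1, (q w).1, (q x).1}) (ho : orient (q v) (q w) (q x) = s v B) :
    ∃ e, Corner q s v e w x ∧ piece q e = B := by
  let e : Triple n m := (⟨{v, w, x}, card_triple hvw hvx hwx⟩, B.2)
  have he : piece q e = B := Prod.ext ((piece_fst (q := q) (e := e) rfl).trans hB.symm) rfl
  exact ⟨e, ⟨hvw, hvx, hwx, rfl, by rw [he, ho]⟩, he⟩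

/-- The two triangles of `B` on the edge `vu` induce opposite orientations on it, so one of them has
the direction prescribed by `s v B`. -/
theorem exists_corner_out (h : PieceEdge q v u B) (s : Fin n → Finset K × Fin m → ℤˣ) :
    ∃ e y, Corner q s v e u y ∧ piece q e = B := by
  obtain ⟨y, h1, h2, h3, h4⟩ := h
  by_cases ho : orient (q v) (q u) (q y) = s v B
  · obtain ⟨e, he⟩ := exists_corner_of_orient h1 h2 h3 h4 ho
    exact ⟨e, y, he⟩
  · obtain ⟨z', g1, g2, g3, g4⟩ := exists_other (q.injective.ne h1) (q.injective.ne h2)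
      (q.injective.ne h3)
    obtain ⟨z, rfl⟩ := q.surjective z'
    have h5 := orient_eq_neg (q.injective.ne h1) (q.injective.ne h2) (q.injective.ne h3) g1 g2 g3 g4
    have h6 : orient (q v) (q u) (q z) = s v B := by
      rw [h5, units_neg_eq_of_ne ho]
    obtain ⟨e, he⟩ := exists_corner_of_orient h1 (fun h => g1 (by rw [h])) (fun h => g2 (by rw [h]))
      (h4.trans g4) h6
    exact ⟨e, z, he⟩

theorem exists_corner_inn (h : PieceEdge q v u B) (s : Fin n → Finset K × Fin m → ℤˣ) :
    ∃ e y, Corner q s v e y u ∧ piece q e = B := by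
  obtain ⟨e, y, he, hB⟩ := exists_corner_out h (fun v B => -s v B)
  exact ⟨e, y, he.swap (by simp), hB⟩

theorem exists_corner (h : v ∈ e.1.1) (s : Fin n → Finset K × Fin m → ℤˣ) :
    ∃ w x, Corner q s v e w x := by
  obtain ⟨w, x, hvw, hvx, hwx, he⟩ :
      ∃ w x, v ≠ w ∧ v ≠ x ∧ w ≠ x ∧ e.1.1 = {v, w, x} := by
    obtain ⟨a, b, c, hab, hac, hbc, he⟩ := Finset.card_eq_three.1 e.1.2
    rw [he] at h
    simp only [Finset.mem_insert, Finset.mem_singleton] at h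
    rcases h with rfl | rfl | rfl
    · exact ⟨b, c, hab, hac, hbc, he⟩
    · exact ⟨a, c, hab.symm, hbc, hac, by rw [he, Finset.insert_comm]⟩
    · exact ⟨a, b, hac.symm, hbc.symm, hab, by rw [he]; ext; simp; tauto⟩
  by_cases ho : orient (q v) (q w) (q x) = s v (piece q e)
  · exact ⟨w, x, hvw, hvx, hwx, he, ho⟩
  · refine ⟨x, w, hvx, hvw, hwx.symm, by rw [he, Finset.pair_comm], ?_⟩
    have h1 : Corner q (fun _ _ => orient (q v) (q w) (q x)) v e w x := ⟨hvw, hvx, hwx, he, rfl⟩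
    rw [h1.orient_swap, units_neg_eq_of_ne ho]

end Corner

/-! ### Rotations obtained from a gluing of the spheres. -/

section Scheme

variable {n m : ℕ} {K : Type*} [LinearOrder K] (q : Fin n ≃ K × Bool)
  (s : Fin n → Finset K × Fin m → ℤˣ)

/-- The edges of `mK_n^3` through `v`. -/
abbrev EdgesAt (n m : ℕ) (v : Fin n) : Type := {e // v ∈ (multiComplete m n).verts e}

/-- The vertex after `v` in the rotation of the edge `e`. -/
noncomputable def out (v : Fin n) (e : EdgesAt n m v) : Fin n :=
  (exists_corner (q := q) e.2 s).choose

/-- The vertex before `v` in the rotation of the edge `e`. -/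
noncomputable def inn (v : Fin n) (e : EdgesAt n m v) : Fin n :=
  (exists_corner (q := q) e.2 s).choose_spec.choose

theorem corner_out_inn (v : Fin n) (e : EdgesAt n m v) :
    Corner q s v e.1 (out q s v e) (inn q s v e) :=
  (exists_corner (q := q) e.2 s).choose_spec.choose_spec

variable {q s}

theorem Corner.out_eq {v w x : Fin n} {e : Triple n m} (h : Corner q s v e w x)
    (he : v ∈ (multiComplete m n).verts e) : out q s v ⟨e, he⟩ = w :=
  ((corner_out_inn q s v ⟨e, he⟩).unique h).1

theorem Corner.inn_eq {v w x : Fin n} {e : Triple n m} (h : Corner q s v e w x)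
    (he : v ∈ (multiComplete m n).verts e) : inn q s v ⟨e, he⟩ = x :=
  ((corner_out_inn q s v ⟨e, he⟩).unique h).2

theorem eq_of_out_eq {v : Fin n} {e f : EdgesAt n m v} (h : out q s v e = out q s v f)
    (hp : piece q e.1 = piece q f.1) : e = f := by
  have he := corner_out_inn q s v e
  have hf := corner_out_inn q s v f
  rw [← h] at hf
  exact Subtype.ext (he.eq_of_out hf hp)

theorem eq_of_inn_eq {v : Fin n} {e f : EdgesAt n m v} (h : inn q s v e = inn q s v f)
    (hp : piece q e.1 = piece q f.1) : e = f := by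
  have he := corner_out_inn q s v e
  have hf := corner_out_inn q s v f
  rw [← h] at hf
  exact Subtype.ext (he.eq_of_inn hf hp)

variable (q s)

/-- Edges through `v` correspond to neighbours of `v` in the spheres, by their edge out of `v`. -/
noncomputable def outEquiv (v : Fin n) :
    EdgesAt n m v ≃ {p : (Finset K × Fin m) × Fin n // PieceEdge q v p.2 p.1} :=
  Equiv.ofBijective
    (fun e => ⟨(piece q e.1, out q s v e), (corner_out_inn q s v e).edge_out⟩) <| by
    constructor
    · intro e f h
      have h' := congrArg Subtype.val h
      exact eq_of_out_eq (congrArg Prod.snd h') (congrArg Prod.fst h')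
    · rintro ⟨⟨B, u⟩, h⟩
      obtain ⟨e, y, he, hB⟩ := exists_corner_out h s
      exact ⟨⟨e, he.mem⟩, Subtype.ext (Prod.ext hB (he.out_eq _))⟩

/-- Edges through `v` correspond to neighbours of `v` in the spheres, by their edge into `v`. -/
noncomputable def innEquiv (v : Fin n) :
    EdgesAt n m v ≃ {p : (Finset K × Fin m) × Fin n // PieceEdge q v p.2 p.1} :=
  Equiv.ofBijective
    (fun e => ⟨(piece q e.1, inn q s v e), (corner_out_inn q s v e).edge_inn⟩) <| by
    constructor
    · intro e f h
      have h' := congrArg Subtype.val h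
      exact eq_of_inn_eq (congrArg Prod.snd h') (congrArg Prod.fst h')
    · rintro ⟨⟨B, u⟩, h⟩
      obtain ⟨e, y, he, hB⟩ := exists_corner_inn h s
      exact ⟨⟨e, he.mem⟩, Subtype.ext (Prod.ext hB (he.inn_eq _))⟩

/-- The rotation of the vertices on an edge. -/
noncomputable def edgeRot (e : Triple n m) : Equiv.Perm {v // v ∈ (multiComplete m n).verts e} where
  toFun v := ⟨out q (fun _ _ => 1) v.1 ⟨e, v.2⟩, (corner_out_inn q _ v.1 ⟨e, v.2⟩).mem_out⟩
  invFun v := ⟨inn q (fun _ _ => 1) v.1 ⟨e, v.2⟩, (corner_out_inn q _ v.1 ⟨e, v.2⟩).mem_inn⟩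
  left_inv v := Subtype.ext <|
    ((corner_out_inn q (fun _ _ => 1) v.1 ⟨e, v.2⟩).rotate_out (s' := fun _ _ => 1) rfl).inn_eq _
  right_inv v := Subtype.ext <|
    ((corner_out_inn q (fun _ _ => 1) v.1 ⟨e, v.2⟩).rotate_inn (s' := fun _ _ => 1) rfl).out_eq _

variable {q s} in
theorem Corner.edgeRot_eq {v w x : Fin n} {e : Triple n m}
    (h : Corner q (fun _ _ => 1) v e w x) (hv : v ∈ (multiComplete m n).verts e)
    (hw : w ∈ (multiComplete m n).verts e) : edgeRot q e ⟨v, hv⟩ = ⟨w, hw⟩ :=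
  Subtype.ext (h.out_eq hv)

theorem edgeRot_sameCycle (e : Triple n m) (x y : {v // v ∈ (multiComplete m n).verts e}) :
    (edgeRot q e).SameCycle x y := by
  obtain ⟨v, hv⟩ := x
  obtain ⟨u, hu⟩ := y
  have h := corner_out_inn q (fun _ _ => 1) v ⟨e, hv⟩
  have hu' : u ∈ e.1.1 := hu
  rw [h.eq] at hu'
  simp only [Finset.mem_insert, Finset.mem_singleton] at hu'
  rcases hu' with rfl | hu' | hu'
  · exact Equiv.Perm.SameCycle.refl _ _
  · have h1 := h.edgeRot_eq hv (hu' ▸ hu)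
    refine ⟨1, ?_⟩
    rw [zpow_one, h1]
    exact Subtype.ext hu'.symm
  · have h1 := (h.rotate_inn (s' := fun _ _ => 1) rfl).edgeRot_eq (hu' ▸ hu) hv
    refine ⟨-1, ?_⟩
    rw [zpow_neg_one, Equiv.Perm.inv_eq_iff_eq, ← h1]
    congr 1
    exact Subtype.ext hu'.symm

variable (π : Fin n → Fin n → Equiv.Perm (Finset K × Fin m))

/-- The gluing of the spheres at the edges of the spheres at `v`. -/
def gluePerm (hπ : ∀ u v B, PieceEdge q v u B ↔ PieceEdge q v u (π u v B)) (v : Fin n) :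
    Equiv.Perm {p : (Finset K × Fin m) × Fin n // PieceEdge q v p.2 p.1} :=
  Equiv.subtypeEquiv
    ⟨fun p => (π p.2 v p.1, p.2), fun p => ((π p.2 v).symm p.1, p.2), fun p => by simp,
      fun p => by simp⟩ (fun p => hπ p.2 v p.1)

/-- The rotation of the edges through a vertex. -/
noncomputable def vertexRot (hπ : ∀ u v B, PieceEdge q v u B ↔ PieceEdge q v u (π u v B))
    (v : Fin n) : Equiv.Perm (EdgesAt n m v) :=
  ((innEquiv q s v).trans (gluePerm q π hπ v)).trans (outEquiv q s v).symm

variable {q s π} {hπ : ∀ u v B, PieceEdge q v u B ↔ PieceEdge q v u (π u v B)}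

theorem vertexRot_eq_iff {v : Fin n} {e f : EdgesAt n m v} :
    vertexRot q s π hπ v e = f ↔
      out q s v f = inn q s v e ∧ piece q f.1 = π (inn q s v e) v (piece q e.1) := by
  unfold vertexRot
  rw [Equiv.trans_apply, Equiv.symm_apply_eq, Equiv.trans_apply, Subtype.ext_iff, Prod.ext_iff]
  constructor
  · exact fun h => ⟨h.2.symm, h.1.symm⟩
  · exact fun h => ⟨h.2.symm, h.1.symm⟩

theorem vertexRot_eq {v u w y : Fin n} {e f : Triple n m}
    (he : Corner q s v e w u) (hf : Corner q s v f u y)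
    (hp : piece q f = π u v (piece q e)) (hve : v ∈ (multiComplete m n).verts e)
    (hvf : v ∈ (multiComplete m n).verts f) :
    vertexRot q s π hπ v ⟨e, hve⟩ = ⟨f, hvf⟩ := by
  rw [vertexRot_eq_iff, he.inn_eq, hf.out_eq]
  exact ⟨rfl, hp⟩

/-- The rotation at `v` enters the edge `vu` through a triangle of `B` and leaves through one of `π
u v B`. The inverse permutation governs the same edge seen from `u`, which leads back and closes the
quadrangle. Signs may differ at the two ends only where `B` is fixed, and there the quadrangle stays
inside one sphere. -/
theorem quadCorner_vertexRot (hinv : ∀ u v, u ≠ v → π u v = (π v u)⁻¹)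
    (hs : ∀ u v B, π u v B ≠ B → s u B = s v B) (v : Fin n) (e f : Triple n m)
    (hve : v ∈ (multiComplete m n).verts e) (hvf : v ∈ (multiComplete m n).verts f)
    (hef : vertexRot q s π hπ v ⟨e, hve⟩ = ⟨f, hvf⟩) :
    ∃ u, ∃ (hue : u ∈ (multiComplete m n).verts e) (huf : u ∈ (multiComplete m n).verts f),
      MultiHypergraph.QuadCorner (vertexRot q s π hπ) (edgeRot q) (fun v e => s v (piece q e))
        hve hvf hue huf := by
  have hne : ∀ a : ℤˣ, a = 1 ∨ a = -1 := Int.units_eq_one_or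
  have sq : ∀ a : ℤˣ, a * a = 1 := Int.units_mul_self
  have he := corner_out_inn q s v ⟨e, hve⟩
  have hf := corner_out_inn q s v ⟨f, hvf⟩
  obtain ⟨h1, h2⟩ := vertexRot_eq_iff.1 hef
  rw [h1] at hf
  generalize inn q s v ⟨e, hve⟩ = u at *
  generalize out q s v ⟨e, hve⟩ = w at *
  generalize inn q s v ⟨f, hvf⟩ = y at *
  dsimp only at he hf h2
  have hback : piece q e = π v u (piece q f) := by
    rw [h2, hinv v u he.ne₂, ← Equiv.Perm.mul_apply, inv_mul_cancel, Equiv.Perm.one_apply]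
  -- Either both spheres have equal signs at `u` and `v`, or the edge is unglued and the rotation at
  -- `u` is read in the opposite sense.
  have hcase : (s u (piece q e) = s v (piece q e) ∧ s u (piece q f) = s v (piece q f)) ∨
      (piece q f = piece q e ∧ s u (piece q e) = -s v (piece q e)) := by
    by_cases hfix : π u v (piece q e) = piece q e
    · rw [hfix] at h2
      rw [h2]
      rcases hne (s u (piece q e)) with g | g <;> rcases hne (s v (piece q e)) with g' | g' <;>
        simp [g, g']
    · refine Or.inl ⟨hs u v _ hfix, hs u v _ ?_⟩
      rw [h2]
      exact fun h => hfix ((π u v).injective h)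
  refine ⟨u, he.mem_inn, hf.mem_out, ?_, ?_, ?_, ?_, ?_, ?_, ?_⟩
  · exact fun h => (he.rotate_inn (s' := fun _ _ => 1) h.symm).edgeRot_eq _ _
  · exact fun h => (he.swap (s' := fun _ _ => 1) (by simp [h])).edgeRot_eq _ _
  · exact fun h => (hf.congr (s' := fun _ _ => 1) h.symm).edgeRot_eq _ _
  · exact fun h => ((hf.swap (s' := fun _ _ => 1) (by simp [h])).rotate_inn
      (s' := fun _ _ => 1) rfl).edgeRot_eq _ _
  · rcases hcase with ⟨g1, g2⟩ | ⟨g1, g2⟩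
    · rw [g1, g2, sq, sq]
    · rw [g1]
  · intro h
    rcases hcase with ⟨g1, g2⟩ | ⟨g1, g2⟩
    · exact vertexRot_eq (hf.rotate_out g2) (he.rotate_inn g1) hback _ _
    · rw [g2, mul_neg, sq] at h
      exact absurd h (by decide)
  · intro h
    rcases hcase with ⟨g1, g2⟩ | ⟨g1, g2⟩
    · rw [g1, sq] at h
      exact absurd h (by decide)
    · refine vertexRot_eq (w := w) (u := v) (y := y) ?_ ?_ ?_ _ _
      · exact (he.rotate_inn (s' := fun v B => -s v B) (by simp [g2])).swap (by simp)
      · exact (hf.rotate_out (s' := fun v B => -s v B) (by simp [g1, g2])).swap (by simp)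
      · rw [g1]
        rw [g1] at hback
        exact hback

end Scheme

/-! ### The choice of the glued edges. -/

/-- A cyclic permutation of a finite set. -/
noncomputable def cyclePerm {α : Type*} [DecidableEq α] [Fintype α] (S : Finset α) : Equiv.Perm α :=
  S.exists_cycleOn.choose

theorem cyclePerm_isCycleOn {α : Type*} [DecidableEq α] [Fintype α] (S : Finset α) :
    (cyclePerm S).IsCycleOn S := S.exists_cycleOn.choose_spec.1

theorem cyclePerm_apply_of_notMem {α : Type*} [DecidableEq α] [Fintype α] {S : Finset α} {a : α}
    (h : a ∉ S) : cyclePerm S a = a := by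
  by_contra h'
  exact h (S.exists_cycleOn.choose_spec.2 (Equiv.Perm.mem_support.2 h'))

section Bar

variable {n : ℕ} {K : Type*} (q : Fin n ≃ K × Bool)

/-- The vertex over the same element of `K`. -/
def bar (v : Fin n) : Fin n := q.symm ((q v).1, !(q v).2)

variable {q} {v u : Fin n}

theorem bar_fst (v : Fin n) : (q (bar q v)).1 = (q v).1 := by simp [bar]

theorem ne_bar (v : Fin n) : v ≠ bar q v := by
  intro h
  have h1 := congrArg (fun x => (q x).2) h
  simp [bar] at h1

theorem eq_bar (h : (q u).1 = (q v).1) (hne : v ≠ u) : u = bar q v := by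
  rw [bar, Equiv.eq_symm_apply]
  refine Prod.ext h (eq_not_of_ne fun h' => hne (q.injective (Prod.ext h.symm h')))

end Bar

namespace PieceEdge

variable {n m : ℕ} {K : Type*} [LinearOrder K] {q : Fin n ≃ K × Bool} {v u : Fin n}
  {B : Finset K × Fin m}

theorem mem_left (h : PieceEdge q v u B) : (q v).1 ∈ B.1 := by
  obtain ⟨y, -, -, -, h⟩ := h
  simp [h]

theorem mem_right (h : PieceEdge q v u B) : (q u).1 ∈ B.1 := h.symm.mem_left

theorem ne (h : PieceEdge q v u B) : v ≠ u := h.choose_spec.1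

theorem card (h : PieceEdge q v u B) : B.1.card = 2 ∨ B.1.card = 3 := by
  obtain ⟨y, h1, h2, h3, h⟩ := h
  have h4 : B.1.card ≤ 3 := h ▸ Finset.card_le_three
  have h5 : 1 < B.1.card := by
    rw [Finset.one_lt_card]
    by_contra! hc
    have e1 : (q v).1 = (q u).1 := hc _ (by simp [h]) _ (by simp [h])
    have e2 : (q v).1 = (q y).1 := hc _ (by simp [h]) _ (by simp [h])
    have e3 := eq_bar e1.symm h1
    have e4 := eq_bar e2.symm h2
    exact h3 (e3.trans e4.symm)
  omega

theorem eq_pair (h : PieceEdge q v u B) (hB : B.1.card = 2) (hne : (q v).1 ≠ (q u).1) :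
    B.1 = {(q v).1, (q u).1} := by
  symm
  apply Finset.eq_of_subset_of_card_le
  · intro k hk
    simp only [Finset.mem_insert, Finset.mem_singleton] at hk
    rcases hk with rfl | rfl
    · exact h.mem_left
    · exact h.mem_right
  · rw [hB, Finset.card_pair hne]

theorem of_bar (hB : B.1.card = 2) (hv : (q v).1 ∈ B.1) : PieceEdge q v (bar q v) B := by
  obtain ⟨k, hk, hk'⟩ : ∃ k ∈ B.1, k ∉ ({(q v).1} : Finset K) := by
    by_contra! hc
    have := Finset.card_le_card (s := B.1) (t := {(q v).1}) hc
    rw [hB, Finset.card_singleton] at this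
    omega
  simp only [Finset.mem_singleton] at hk'
  have hy : (q (q.symm (k, true))).1 = k := by simp
  refine ⟨q.symm (k, true), ne_bar v, fun h' => hk' (by rw [h', hy]),
    fun h' => hk' (by rw [← bar_fst (q := q) v, h', hy]), ?_⟩
  rw [hy, bar_fst]
  symm
  apply Finset.eq_of_subset_of_card_le
  · intro l hl
    simp only [Finset.mem_insert, Finset.mem_singleton] at hl
    rcases hl with rfl | rfl | rfl <;> assumption
  · rw [hB, Finset.insert_idem, Finset.card_pair (Ne.symm hk')]

theorem of_ne (h : (q v).1 ≠ (q u).1) (c : Fin m) :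
    PieceEdge q v u ({(q v).1, (q u).1}, c) := by
  refine ⟨bar q v, fun h' => h (by rw [h']), ne_bar v, fun h' => h (by rw [h', bar_fst]), ?_⟩
  rw [bar_fst]
  ext
  simp
  tauto

end PieceEdge

section Gluing

variable {n m : ℕ} {K : Type*} [LinearOrder K] [Fintype K] (q : Fin n ≃ K × Bool)

/-- A perfect matching of the vertices of an octahedron by edges of the octahedron. -/
def OctMatch (S : Finset K) (v u : Fin n) : Prop :=
  ((q v).2 = true ∧ (q u).2 = false ∧ (q u).1 = cyclePerm S (q v).1) ∨
    ((q u).2 = true ∧ (q v).2 = false ∧ (q v).1 = cyclePerm S (q u).1)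

/-- The edges along which a sphere is glued: a tetrahedron is glued to the other tetrahedra along
its two edges over single elements of `K`, the central copy of a tetrahedron also takes part in the
gluing of the octahedra along its other edges, and an octahedron is glued along its matching. -/
def Attached (v u : Fin n) (B : Finset K × Fin m) : Prop :=
  (B.1.card = 2 ∧ ((q v).1 = (q u).1 ∨ (B.2 : ℕ) = 0)) ∨ (B.1.card = 3 ∧ OctMatch q B.1 v u)

variable {q} {v u u' w : Fin n} {B : Finset K × Fin m}

theorem OctMatch.symm {S : Finset K} (h : OctMatch q S v u) : OctMatch q S u v := Or.symm h

theorem OctMatch.unique {S : Finset K} (h : OctMatch q S v u) (h' : OctMatch q S v u') :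
    u = u' := by
  apply q.injective
  rcases h with ⟨h1, h2, h3⟩ | ⟨h1, h2, h3⟩ <;> rcases h' with ⟨g1, g2, g3⟩ | ⟨g1, g2, g3⟩
  · exact Prod.ext (h3.trans g3.symm) (h2.trans g2.symm)
  · exact absurd (h1.symm.trans g2) (by decide)
  · exact absurd (h2.symm.trans g1) (by decide)
  · exact Prod.ext ((cyclePerm S).injective (h3.symm.trans g3)) (h1.trans g1.symm)

theorem OctMatch.mem {S : Finset K} (h : OctMatch q S v u) (hv : (q v).1 ∈ S) : (q u).1 ∈ S := by
  rcases h with ⟨-, -, h⟩ | ⟨-, -, h⟩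
  · rw [h]
    exact (cyclePerm_isCycleOn S).apply_mem_iff.2 hv
  · rw [h] at hv
    exact (cyclePerm_isCycleOn S).apply_mem_iff.1 hv

/-- A cyclic permutation of three elements has no fixed point, so the matching avoids antipodal
pairs, which are not edges of the octahedron. -/
theorem OctMatch.ne {S : Finset K} (h : OctMatch q S v u) (hv : (q v).1 ∈ S) (hS : S.card = 3) :
    (q v).1 ≠ (q u).1 := by
  have hnt : (S : Set K).Nontrivial := Finset.one_lt_card_iff_nontrivial.1 (by omega)
  have hu := h.mem hv
  rcases h with ⟨-, -, h⟩ | ⟨-, -, h⟩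
  · rw [h]
    exact ((cyclePerm_isCycleOn S).apply_ne hnt hv).symm
  · rw [h]
    exact (cyclePerm_isCycleOn S).apply_ne hnt hu

theorem exists_octMatch (S : Finset K) (v : Fin n) : ∃ u, OctMatch q S v u := by
  rcases h : (q v).2
  · exact ⟨q.symm ((cyclePerm S).symm (q v).1, true), Or.inr (by simp [h])⟩
  · exact ⟨q.symm (cyclePerm S (q v).1, false), Or.inl (by simp [h])⟩

theorem Attached.symm (h : Attached q v u B) : Attached q u v B := by
  rcases h with ⟨h1, h2⟩ | ⟨h1, h2⟩
  · exact Or.inl ⟨h1, h2.imp_left Eq.symm⟩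
  · exact Or.inr ⟨h1, h2.symm⟩

namespace PieceEdge

theorem of_octMatch (hB : B.1.card = 3) (hv : (q v).1 ∈ B.1) (h : OctMatch q B.1 v u) :
    PieceEdge q v u B := by
  have hu := h.mem hv
  have hne := h.ne hv hB
  obtain ⟨k, hk, hk'⟩ : ∃ k ∈ B.1, k ∉ ({(q v).1, (q u).1} : Finset K) := by
    by_contra! hc
    have := Finset.card_le_card (s := B.1) (t := {(q v).1, (q u).1}) hc
    rw [hB, Finset.card_pair hne] at this
    omega
  simp only [Finset.mem_insert, Finset.mem_singleton, not_or] at hk'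
  have hy : (q (q.symm (k, true))).1 = k := by simp
  refine ⟨q.symm (k, true), fun h' => hne (by rw [h']), fun h' => hk'.1 (by rw [h', hy]),
    fun h' => hk'.2 (by rw [h', hy]), ?_⟩
  symm
  rw [hy]
  apply Finset.eq_of_subset_of_card_le
  · intro l hl
    simp only [Finset.mem_insert, Finset.mem_singleton] at hl
    rcases hl with rfl | rfl | rfl <;> assumption
  · rw [hB, Finset.card_eq_three.2 ⟨_, _, _, hne, Ne.symm hk'.1, Ne.symm hk'.2, rfl⟩]

end PieceEdge

open Classical in
variable (q) in
/-- The spheres glued together along an edge. -/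
noncomputable def glued (v u : Fin n) : Finset (Finset K × Fin m) :=
  {B | PieceEdge q v u B ∧ Attached q v u B}

theorem mem_glued : B ∈ glued q v u ↔ PieceEdge q v u B ∧ Attached q v u B := by
  simp [glued]

theorem glued_symm (v u : Fin n) : glued (m := m) q v u = glued q u v := by
  ext B
  rw [mem_glued, mem_glued]
  exact ⟨fun h => ⟨h.1.symm, h.2.symm⟩, fun h => ⟨h.1.symm, h.2.symm⟩⟩

variable (q) in
/-- The gluing permutation along an edge. -/
noncomputable def glue (v u : Fin n) : Equiv.Perm (Finset K × Fin m) :=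
  if v < u then cyclePerm (glued q v u) else (cyclePerm (glued q u v))⁻¹

/-- The order on `Fin n` selects the end of the edge at which the cyclic permutation itself is used;
the other end gets its inverse. -/
theorem glue_inv (hvu : v ≠ u) : glue (m := m) q v u = (glue q u v)⁻¹ := by
  unfold glue
  rcases lt_or_gt_of_ne hvu with h | h
  · simp [h, h.not_gt]
  · simp [h, h.not_gt]

theorem glue_isCycleOn (v u : Fin n) : (glue q v u).IsCycleOn
    ((glued q v u : Finset (Finset K × Fin m)) : Set (Finset K × Fin m)) := by
  unfold glue
  split_ifs
  · exact cyclePerm_isCycleOn _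
  · rw [glued_symm]
    exact (cyclePerm_isCycleOn _).inv

theorem glue_apply_of_notMem (h : B ∉ glued q v u) : glue q v u B = B := by
  unfold glue
  split_ifs
  · exact cyclePerm_apply_of_notMem h
  · rw [glued_symm] at h
    rw [Equiv.Perm.inv_eq_iff_eq, cyclePerm_apply_of_notMem h]

theorem pieceEdge_glue_iff (u v : Fin n) (B : Finset K × Fin m) :
    PieceEdge q v u B ↔ PieceEdge q v u (glue q u v B) := by
  by_cases h : B ∈ glued q u v
  · have h' := (glue_isCycleOn u v).apply_mem_iff.2 h
    exact ⟨fun _ => (mem_glued.1 h').1.symm, fun _ => (mem_glued.1 h).1.symm⟩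
  · rw [glue_apply_of_notMem h]

end Gluing

/-! ### Each vertex rotation is a single cycle. -/

section Cycle

variable {n m : ℕ} {K : Type*} [LinearOrder K] (q : Fin n ≃ K × Bool)
  (s : Fin n → Finset K × Fin m → ℤˣ)

/-- The rotation at `v` in the disjoint union of the spheres. -/
noncomputable def linkPerm (v : Fin n) : Equiv.Perm (EdgesAt n m v) :=
  (innEquiv q s v).trans (outEquiv q s v).symm

variable {q s} {v : Fin n}

theorem linkPerm_spec (e : EdgesAt n m v) :
    out q s v (linkPerm q s v e) = inn q s v e ∧ piece q (linkPerm q s v e).1 = piece q e.1 := by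
  have h : outEquiv q s v (linkPerm q s v e) = innEquiv q s v e := by simp [linkPerm]
  have h' := congrArg Subtype.val h
  exact ⟨congrArg Prod.snd h', congrArg Prod.fst h'⟩

variable [Fintype K]

variable (q s) in
/-- The gluing of the spheres at `v`, as a permutation of the edges through `v`. -/
noncomputable def glueAt (v : Fin n) : Equiv.Perm (EdgesAt n m v) :=
  ((outEquiv q s v).trans (gluePerm q (glue q) pieceEdge_glue_iff v)).trans (outEquiv q s v).symm

theorem glueAt_spec (e : EdgesAt n m v) :
    out q s v (glueAt q s v e) = out q s v e ∧
      piece q (glueAt q s v e).1 = glue q (out q s v e) v (piece q e.1) := by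
  have h : outEquiv q s v (glueAt q s v e) =
      gluePerm q (glue q) pieceEdge_glue_iff v (outEquiv q s v e) := by simp [glueAt]
  have h' := congrArg Subtype.val h
  exact ⟨congrArg Prod.snd h', congrArg Prod.fst h'⟩

/-- The rotation at `v` factors into a turn within a sphere and a change of sphere. If one factor
preserves the cycles of the product, so does the other. -/
theorem glueAt_linkPerm (e : EdgesAt n m v) :
    glueAt q s v (linkPerm q s v e) = vertexRot q s (glue q) pieceEdge_glue_iff v e := by
  simp [glueAt, linkPerm, vertexRot]

/-- Being in the same cycle of the rotation at `v`. -/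
def Conn (e f : EdgesAt n m v) : Prop :=
  (vertexRot q s (glue q) pieceEdge_glue_iff v).SameCycle e f

variable (q s v) in
theorem conn_equivalence : Equivalence (Conn (q := q) (s := s) (v := v)) :=
  ⟨Equiv.Perm.SameCycle.refl _, fun h => h.symm, fun h h' => h.trans h'⟩

theorem conn_glueAt_linkPerm (e : EdgesAt n m v) :
    Conn (q := q) (s := s) e (glueAt q s v (linkPerm q s v e)) :=
  ⟨1, by rw [zpow_one, glueAt_linkPerm]⟩

/-- The last unglued edge of a sphere at `v` is glued. -/
theorem conn_glueAt_of_link {x : EdgesAt n m v}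
    (h : ∀ y, piece q y.1 = piece q x.1 → y ≠ x → Conn (q := q) (s := s) y (glueAt q s v y)) :
    Conn (q := q) (s := s) x (glueAt q s v x) := by
  have hr := conn_equivalence q s v
  have hsymm : ∀ y, Conn (q := q) (s := s) ((linkPerm q s v).symm y) (glueAt q s v y) := by
    intro y
    have := conn_glueAt_linkPerm (q := q) (s := s) ((linkPerm q s v).symm y)
    rwa [Equiv.apply_symm_apply] at this
  have h1 : Conn (q := q) (s := s) x ((linkPerm q s v).symm x) := by
    refine rel_apply_of_forall_ne (linkPerm q s v).symm hr
      (fun y => piece q y.1 = piece q x.1) ?_ rfl ?_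
    · intro y hy
      have := (linkPerm_spec (q := q) (s := s) ((linkPerm q s v).symm y)).2
      rw [Equiv.apply_symm_apply] at this
      rw [← this, hy]
    · intro y hy hne
      exact hr.trans (h y hy hne) (hr.symm (hsymm y))
  exact hr.trans h1 (hsymm x)

theorem glueAt_eq_self {x : EdgesAt n m v} (h : piece q x.1 ∉ glued q (out q s v x) v) :
    glueAt q s v x = x := by
  have h1 := glueAt_spec (q := q) (s := s) x
  rw [glue_apply_of_notMem h] at h1
  exact eq_of_out_eq h1.1 h1.2

theorem conn_glueAt_of_notMem {x : EdgesAt n m v} (h : piece q x.1 ∉ glued q (out q s v x) v) :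
    Conn (q := q) (s := s) x (glueAt q s v x) := by
  rw [glueAt_eq_self h]
  exact (conn_equivalence q s v).refl _

/-- The last unglued sphere along an edge is glued. -/
theorem conn_glueAt_of_glued {x : EdgesAt n m v}
    (h : ∀ y, out q s v y = out q s v x → piece q y.1 ∈ glued q (out q s v x) v → y ≠ x →
      Conn (q := q) (s := s) y (glueAt q s v y)) :
    Conn (q := q) (s := s) x (glueAt q s v x) := by
  by_cases hx : piece q x.1 ∈ glued q (out q s v x) v
  · refine rel_apply_of_forall_ne (glueAt q s v) (conn_equivalence q s v)
      (fun y => out q s v y = out q s v x ∧ piece q y.1 ∈ glued q (out q s v x) v) ?_ ⟨rfl, hx⟩ ?_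
    · rintro y ⟨h1, h2⟩
      obtain ⟨g1, g2⟩ := glueAt_spec (q := q) (s := s) y
      refine ⟨g1.trans h1, ?_⟩
      rw [g2, h1]
      exact (glue_isCycleOn _ _).apply_mem_iff.2 h2
    · exact fun y hy hne => h y hy.1 hy.2 hne
  · exact conn_glueAt_of_notMem hx

/-- The tree of spheres at `v` is pruned from its leaves. An octahedron has only one glued edge at
`v`, so `conn_glueAt_of_link` settles it. At an edge over two elements of `K`, at most one glued
sphere is a tetrahedron, settled last by `conn_glueAt_of_glued`. A tetrahedron then has only its
edge to `bar v` left. -/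
theorem conn_glueAt (x : EdgesAt n m v) : Conn (q := q) (s := s) x (glueAt q s v x) := by
  have edge : ∀ y : EdgesAt n m v, PieceEdge q v (out q s v y) (piece q y.1) :=
    fun y => (corner_out_inn q s v y).edge_out
  have oct : ∀ x : EdgesAt n m v, (piece q x.1).1.card = 3 →
      Conn (q := q) (s := s) x (glueAt q s v x) := by
    intro x hx
    have hnot : ∀ y : EdgesAt n m v, piece q y.1 = piece q x.1 →
        ¬ OctMatch q (piece q x.1).1 v (out q s v y) →
        Conn (q := q) (s := s) y (glueAt q s v y) := by
      intro y hy hm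
      apply conn_glueAt_of_notMem
      intro h
      rcases (mem_glued.1 h).2.symm with h' | h'
      · rw [hy] at h'
        omega
      · exact hm (hy ▸ h'.2)
    by_cases hm : OctMatch q (piece q x.1).1 v (out q s v x)
    · apply conn_glueAt_of_link
      intro y hy hne
      exact hnot y hy fun hm' => hne (eq_of_out_eq (hm'.unique hm) hy)
    · exact hnot x rfl hm
  have side : ∀ x : EdgesAt n m v, (q v).1 ≠ (q (out q s v x)).1 →
      Conn (q := q) (s := s) x (glueAt q s v x) := by
    intro x hx
    have two : ∀ y : EdgesAt n m v, out q s v y = out q s v x → (piece q y.1).1.card = 2 →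
        piece q y.1 ∈ glued q (out q s v x) v →
        (piece q y.1).1 = {(q v).1, (q (out q s v x)).1} ∧ ((piece q y.1).2 : ℕ) = 0 := by
      intro y hy h2 h
      refine ⟨(hy ▸ edge y).eq_pair h2 hx, ?_⟩
      rcases (mem_glued.1 h).2 with h' | h'
      · exact h'.2.resolve_left (Ne.symm hx)
      · omega
    by_cases hm : piece q x.1 ∈ glued q (out q s v x) v
    · rcases (edge x).card with hx2 | hx3
      · apply conn_glueAt_of_glued
        intro y hy hyG hne
        rcases (edge y).card with hy2 | hy3
        · refine absurd (eq_of_out_eq hy ?_) hne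
          obtain ⟨a1, a2⟩ := two x rfl hx2 hm
          obtain ⟨b1, b2⟩ := two y hy hy2 hyG
          exact Prod.ext (b1.trans a1.symm) (Fin.ext (b2.trans a2.symm))
        · exact oct y hy3
      · exact oct x hx3
    · exact conn_glueAt_of_notMem hm
  by_cases hx : (q v).1 = (q (out q s v x)).1
  · apply conn_glueAt_of_link
    intro y hy hne
    apply side
    intro hy'
    exact hne (eq_of_out_eq ((eq_bar hy'.symm (edge y).ne).trans (eq_bar hx.symm (edge x).ne).symm)
      hy)
  · exact side x hx

theorem conn_linkPerm (x : EdgesAt n m v) : Conn (q := q) (s := s) x (linkPerm q s v x) :=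
  (conn_equivalence q s v).trans (conn_glueAt_linkPerm x)
    ((conn_equivalence q s v).symm (conn_glueAt _))

/-- Edges in the same sphere are in the same cycle. -/
theorem conn_of_piece_eq {x y : EdgesAt n m v} (h : piece q x.1 = piece q y.1) :
    Conn (q := q) (s := s) x y := by
  have hr := conn_equivalence q s v
  set x₁ := linkPerm q s v x with hx₁
  set x₂ := linkPerm q s v x₁ with hx₂
  set x₃ := linkPerm q s v x₂ with hx₃
  obtain ⟨o1, p1⟩ := linkPerm_spec (q := q) (s := s) x
  obtain ⟨o2, p2⟩ := linkPerm_spec (q := q) (s := s) x₁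
  obtain ⟨o3, p3⟩ := linkPerm_spec (q := q) (s := s) x₂
  rw [← hx₁] at o1 p1
  rw [← hx₂] at o2 p2
  rw [← hx₃] at o3 p3
  have c0 := corner_out_inn q s v x
  have c1 := corner_out_inn q s v x₁
  have c2 := corner_out_inn q s v x₂
  have cy := corner_out_inn q s v y
  have r1 : Conn (q := q) (s := s) x x₁ := conn_linkPerm x
  have r2 : Conn (q := q) (s := s) x x₂ := hr.trans r1 (conn_linkPerm x₁)
  have r3 : Conn (q := q) (s := s) x x₃ := hr.trans r2 (conn_linkPerm x₂)
  have hinn : ∀ e : EdgesAt n m v, inn q s v (linkPerm q s v e) ≠ out q s v e := by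
    intro e he
    obtain ⟨o, p⟩ := linkPerm_spec (q := q) (s := s) e
    have c := corner_out_inn q s v e
    have c' := corner_out_inn q s v (linkPerm q s v e)
    rw [o, he] at c'
    have h1 := c.orient_swap
    rw [c'.orient_eq, p] at h1
    rcases Int.units_eq_one_or (s v (piece q e.1)) with h2 | h2 <;> rw [h2] at h1 <;>
      exact absurd h1 (by decide)
  -- Four successive triangles around `v` exhaust its link, which has length three in a tetrahedron
  -- and four in an octahedron.
  have key := mem_link (q.injective.ne c0.ne₁) (q.injective.ne c0.ne₂) (q.injective.ne c0.ne₃)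
    (q.injective.ne c1.ne₂) (o1 ▸ q.injective.ne c1.ne₃) (q.injective.ne (hinn x).symm)
    (by rw [← c0.piece_eq, ← p1, c1.piece_eq, o1])
    (q.injective.ne c2.ne₂) (o2 ▸ q.injective.ne c2.ne₃)
    (o1 ▸ q.injective.ne (hinn x₁).symm)
    (by rw [← c0.piece_eq, ← p1, ← p2, c2.piece_eq, o2])
    (q.injective.ne cy.ne₁) (q.injective.ne cy.ne₂) (q.injective.ne cy.ne₃)
    (by rw [← c0.piece_eq, h, cy.piece_eq])
  rcases key with h' | h' | h' | h'
  · rw [eq_of_out_eq (q.injective h') h.symm]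
    exact hr.refl _
  · rwa [eq_of_out_eq (e := y) (f := x₁) ((q.injective h').trans o1.symm) (h.symm.trans p1.symm)]
  · rwa [eq_of_out_eq (e := y) (f := x₂) ((q.injective h').trans o2.symm)
      (h.symm.trans (p2.trans p1).symm)]
  · rwa [eq_of_out_eq (e := y) (f := x₃) ((q.injective h').trans o3.symm)
      (h.symm.trans ((p3.trans p2).trans p1).symm)]

/-- Spheres glued along an edge at `v` are in the same cycle. -/
theorem conn_of_glued {u : Fin n} {x y : EdgesAt n m v} (hx : piece q x.1 ∈ glued q u v)
    (hy : piece q y.1 ∈ glued q u v) : Conn (q := q) (s := s) x y := by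
  have hr := conn_equivalence q s v
  have hout : ∀ z : EdgesAt n m v, piece q z.1 ∈ glued q u v →
      ∃ z' : EdgesAt n m v, piece q z'.1 = piece q z.1 ∧ out q s v z' = u := by
    intro z hz
    obtain ⟨e, w, he, hp⟩ := exists_corner_out (mem_glued.1 hz).1.symm s
    exact ⟨⟨e, he.mem⟩, hp, he.out_eq _⟩
  obtain ⟨x', px, ox⟩ := hout x hx
  obtain ⟨y', py, oy⟩ := hout y hy
  obtain ⟨i, -, hi⟩ := (glue_isCycleOn u v).exists_pow_eq hx hy
  have pow : ∀ i : ℕ, out q s v ((glueAt q s v ^ i) x') = u ∧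
      piece q ((glueAt q s v ^ i) x').1 = (glue q u v ^ i) (piece q x'.1) ∧
      Conn (q := q) (s := s) x' ((glueAt q s v ^ i) x') := by
    intro i
    induction i with
    | zero => exact ⟨ox, rfl, hr.refl _⟩
    | succ i ih =>
      obtain ⟨h1, h2, h3⟩ := ih
      rw [pow_succ', Equiv.Perm.mul_apply, pow_succ', Equiv.Perm.mul_apply]
      obtain ⟨g1, g2⟩ := glueAt_spec (q := q) (s := s) ((glueAt q s v ^ i) x')
      exact ⟨g1.trans h1, by rw [g2, h1, h2], hr.trans h3 (conn_glueAt _)⟩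
  obtain ⟨-, h2, h3⟩ := pow i
  refine hr.trans (conn_of_piece_eq px.symm) (hr.trans h3 (conn_of_piece_eq ?_))
  rw [h2, px, hi]

/-- The rotation at every vertex is a single cycle. -/
theorem vertexRot_sameCycle (x y : EdgesAt n m v) :
    (vertexRot q s (glue q) pieceEdge_glue_iff v).SameCycle x y := by
  have hr := conn_equivalence q s v
  have edge : ∀ y : EdgesAt n m v, PieceEdge q v (out q s v y) (piece q y.1) :=
    fun y => (corner_out_inn q s v y).edge_out
  have htetra : ∀ x : EdgesAt n m v,
      ∃ x' : EdgesAt n m v, Conn (q := q) (s := s) x x' ∧ (piece q x'.1).1.card = 2 := by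
    intro x
    rcases (edge x).card with h | h
    · exact ⟨x, hr.refl _, h⟩
    · obtain ⟨u, hu⟩ := exists_octMatch (q := q) (piece q x.1).1 v
      have hv := (edge x).mem_left
      have hne := hu.ne hv h
      -- The central copy of the tetrahedron under the matching edge is the one to which the
      -- octahedron is glued.
      let T : Finset K × Fin m := ({(q v).1, (q u).1}, ⟨0, (piece q x.1).2.pos⟩)
      have hT : T.1.card = 2 := Finset.card_pair hne
      have e1 : PieceEdge q v u T := PieceEdge.of_ne hne _
      obtain ⟨e, w, he, hp⟩ := exists_corner_out e1 s
      refine ⟨⟨e, he.mem⟩, conn_of_glued (u := u) (mem_glued.2 ⟨?_, ?_⟩)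
        (mem_glued.2 ⟨?_, ?_⟩), by rw [hp, hT]⟩
      · exact (PieceEdge.of_octMatch h hv hu).symm
      · exact Or.inr ⟨h, hu.symm⟩
      · rw [hp]
        exact e1.symm
      · rw [hp]
        exact Or.inl ⟨hT, Or.inr rfl⟩
  obtain ⟨x', hx, hx2⟩ := htetra x
  obtain ⟨y', hy, hy2⟩ := htetra y
  have hbar : ∀ z : EdgesAt n m v, (piece q z.1).1.card = 2 →
      piece q z.1 ∈ glued q (bar q v) v := fun z hz =>
    mem_glued.2 ⟨(PieceEdge.of_bar hz (edge z).mem_left).symm, Or.inl ⟨hz, Or.inl (bar_fst v)⟩⟩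
  exact hr.trans hx (hr.trans (conn_of_glued (hbar x' hx2) (hbar y' hy2)) (hr.symm hy))

end Cycle

/-! ### Orientable and non-orientable quadrangular embeddings. -/

section Existence

variable {n m : ℕ} {K : Type*} [LinearOrder K] [Fintype K] (q : Fin n ≃ K × Bool)

/-- The embedding scheme of the Levi graph of `mK_n^3` obtained by gluing the spheres. -/
noncomputable def gluedScheme (s : Fin n → Finset K × Fin m → ℤˣ) :
    EmbeddingScheme (multiComplete m n).leviGraph :=
  (multiComplete m n).leviScheme (vertexRot q s (glue q) pieceEdge_glue_iff)
    (fun _ => vertexRot_sameCycle) (edgeRot q) (edgeRot_sameCycle q) (fun v e => s v (piece q e))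

theorem gluedScheme_quad {s : Fin n → Finset K × Fin m → ℤˣ}
    (hs : ∀ u v B, glue q u v B ≠ B → s u B = s v B)
    (t : (multiComplete m n).leviGraph.Dart × ℤˣ) : (gluedScheme q s).Quad t :=
  MultiHypergraph.leviScheme_quad
    (quadCorner_vertexRot (fun _ _ h => glue_inv h) hs) t

theorem exists_orientable_quad (q : Fin n ≃ K × Bool) :
    ∃ Φ : EmbeddingScheme (multiComplete m n).leviGraph, Φ.IsOrientable ∧ ∀ t, Φ.Quad t := by
  refine ⟨gluedScheme q (fun _ _ => 1), ⟨fun _ => 1, ?_⟩, gluedScheme_quad q (by simp)⟩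
  rintro ⟨⟨x | x, y | y⟩, hxy⟩
  · exact ((multiComplete m n).leviGraph_not_adj_inl_inl _ _ hxy).elim
  · rfl
  · rfl
  · exact ((multiComplete m n).leviGraph_not_adj_inr_inr _ _ hxy).elim

variable {q}

theorem Attached.unique {v u u' : Fin n} {B : Finset K × Fin m} (h : Attached q v u B)
    (h' : Attached q v u' B) (hu : v ≠ u) (hu' : v ≠ u') (hB : B.1.card = 3 ∨ (B.2 : ℕ) ≠ 0) :
    u = u' := by
  rcases h with ⟨h1, h2⟩ | ⟨h1, h2⟩ <;> rcases h' with ⟨g1, g2⟩ | ⟨g1, g2⟩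
  · have hB' : ¬ (B.2 : ℕ) = 0 := hB.resolve_left (by omega)
    rw [eq_bar (h2.resolve_right hB').symm hu, eq_bar (g2.resolve_right hB').symm hu']
  · omega
  · omega
  · exact h2.unique g2

/-- Twisting a sphere that is glued along a matching only makes the surface non-orientable. -/
theorem exists_nonorientable_quad_of_edge {v u z : Fin n} {B B' : Finset K × Fin m}
    (hB : B.1.card = 3 ∨ (B.2 : ℕ) ≠ 0) (hvu : v ≠ u) (hatt : Attached q v u B)
    (hz : PieceEdge q v z B) (hzu : z ≠ u) (hz' : PieceEdge q v z B') (hBB' : B' ≠ B) :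
    ∃ Φ : EmbeddingScheme (multiComplete m n).leviGraph, ¬ Φ.IsOrientable ∧ ∀ t, Φ.Quad t := by
  -- Both ends of the glued edge `vu` are twisted, so the signs agree along every glued edge of `B`:
  -- by uniqueness no other glued edge of `B` meets `v` or `u`.
  let s : Fin n → Finset K × Fin m → ℤˣ := fun w C => if C = B ∧ (w = v ∨ w = u) then -1 else 1
  have hend : ∀ {a b : Fin n}, Attached q a b B → a ≠ b → (a = v ∨ a = u) → (b = v ∨ b = u) := by
    rintro a b hab hne (rfl | rfl)
    · exact Or.inr (hab.unique hatt hne hvu hB)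
    · exact Or.inl (hab.unique hatt.symm hne hvu.symm hB)
  refine ⟨gluedScheme q s, ?_, gluedScheme_quad q ?_⟩
  · rintro ⟨σ, hσ⟩
    obtain ⟨e, y, he, hp⟩ := exists_corner_out hz (fun _ _ => 1)
    obtain ⟨f, y', hf, hp'⟩ := exists_corner_out hz' (fun _ _ => 1)
    -- The closed walk `v e z f`, with `e` in `B` and `f` in `B'`, has just one negative edge,
    -- namely `ve`; no switching can make all its signs positive.
    have key : ∀ (w : Fin n) (g : Triple n m), w ∈ g.1.1 →
        σ (Sum.inl w) * s w (piece q g) * σ (Sum.inr g) = 1 := fun w g hw =>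
      hσ (MultiHypergraph.outDart (H := multiComplete m n) (v := w) (e := g) hw)
    have h1 := key v e he.mem
    have h2 := key z e he.mem_out
    have h3 := key v f hf.mem
    have h4 := key z f hf.mem_out
    have s1 : s v (piece q e) = -1 := by simp [s, hp]
    have s2 : s z (piece q e) = 1 := by simp [s, hz.ne.symm, hzu]
    have s3 : s v (piece q f) = 1 := by simp [s, hp', hBB']
    have s4 : s z (piece q f) = 1 := by simp [s, hp', hBB']
    rw [s1] at h1
    rw [s2] at h2
    rw [s3] at h3
    rw [s4] at h4
    clear_value s
    revert h1 h2 h3 h4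
    generalize σ (Sum.inl v) = a
    generalize σ (Sum.inl z) = b
    generalize σ (Sum.inr e) = c
    generalize σ (Sum.inr f) = d
    revert a b c d
    decide
  · intro a b C hC
    by_cases hCB : C = B
    · subst hCB
      have hmem : C ∈ glued q a b := by
        by_contra h
        exact hC (glue_apply_of_notMem h)
      obtain ⟨h1, h2⟩ := mem_glued.1 hmem
      have hiff : (a = v ∨ a = u) ↔ (b = v ∨ b = u) := ⟨hend h2 h1.ne, hend h2.symm h1.ne.symm⟩
      simp [s, hiff]
    · simp [s, hCB]

/-- The twisted sphere is a non-central tetrahedron if `m ≥ 2`, and an octahedron if `N ≥ 3`. The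
second sphere on the edge `vz` is the central tetrahedron. -/
theorem exists_nonorientable_quad {N : ℕ} (q : Fin n ≃ Fin N × Bool) (hN : 2 ≤ N) (hm : 1 ≤ m)
    (h : 2 ≤ m ∨ 3 ≤ N) :
    ∃ Φ : EmbeddingScheme (multiComplete m n).leviGraph, ¬ Φ.IsOrientable ∧ ∀ t, Φ.Quad t := by
  let k₀ : Fin N := ⟨0, by omega⟩
  let k₁ : Fin N := ⟨1, by omega⟩
  have h01 : k₀ ≠ k₁ := by simp [k₀, k₁]
  let v := q.symm (k₀, true)
  have hv : (q v).1 = k₀ := by simp [v]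
  rcases h with h | h
  · let z := q.symm (k₁, true)
    have hz : (q z).1 = k₁ := by simp [z]
    have hvz : (q v).1 ≠ (q z).1 := by rw [hv, hz]; exact h01
    have hbar : z ≠ bar q v := fun h' => hvz (by rw [h', bar_fst])
    refine exists_nonorientable_quad_of_edge (q := q) (v := v) (u := bar q v) (z := z)
      (B := ({(q v).1, (q z).1}, ⟨1, h⟩)) (B' := ({(q v).1, (q z).1}, ⟨0, hm⟩))
      (Or.inr one_ne_zero) (ne_bar v) (Or.inl ⟨Finset.card_pair hvz, Or.inl (bar_fst v).symm⟩)
      (PieceEdge.of_ne hvz _) hbar (PieceEdge.of_ne hvz _) (by simp)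
  · let k₂ : Fin N := ⟨2, h⟩
    have h02 : k₀ ≠ k₂ := by simp [k₀, k₂]
    have h12 : k₁ ≠ k₂ := by simp [k₁, k₂]
    let S : Finset (Fin N) := {k₀, k₁, k₂}
    have hS : S.card = 3 := Finset.card_eq_three.2 ⟨_, _, _, h01, h02, h12, rfl⟩
    obtain ⟨u, hu⟩ := exists_octMatch (q := q) S v
    have hvu := hu.ne (by simp [hv, S]) hS
    -- The second coordinate is flipped so that `z ≠ u` even if `u` lies over `k₁`.
    let z := q.symm (k₁, !(q u).2)
    have hz : q z = (k₁, !(q u).2) := by simp [z]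
    have hvz : (q v).1 ≠ (q z).1 := by rw [hv, hz]; exact h01
    have hzu : z ≠ u := fun h' => by
      have := congrArg (fun x => (q x).2) h'
      simp [hz] at this
    refine exists_nonorientable_quad_of_edge (q := q) (v := v) (u := u) (z := z)
      (B := (S, ⟨0, hm⟩)) (B' := ({(q v).1, (q z).1}, ⟨0, hm⟩))
      (Or.inl hS) (fun h' => hvu (by rw [h'])) (Or.inr ⟨hS, hu⟩)
      ⟨q.symm (k₂, true), ?_, ?_, ?_, ?_⟩ hzu (PieceEdge.of_ne hvz _) ?_
    · exact fun h' => hvz (by rw [h'])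
    · exact fun h' => h02 (by rw [← hv, h']; simp)
    · exact fun h' => h12 (by have := congrArg (fun x => (q x).1) h'; simpa [hz] using this)
    · simp [S, hv, hz]
    · intro h'
      have h2 : ({(q v).1, (q z).1} : Finset (Fin N)) = S := congrArg Prod.fst h'
      rw [← h2, Finset.card_pair hvz] at hS
      omega

end Existence

/-! ### Counting and the Euler characteristic. -/

section Count

theorem MultiHypergraph.card_edgeSet_leviGraph {V E : Type*} [Fintype V] [Fintype E]
    (H : MultiHypergraph V E) :
    Nat.card H.leviGraph.edgeSet = ∑ e, (H.verts e).card := by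
  let F : (Σ e, {v // v ∈ H.verts e}) → H.leviGraph.edgeSet := fun p =>
    ⟨s(Sum.inl p.2.1, Sum.inr p.1), (H.leviGraph_adj_inl_inr _ _).2 p.2.2⟩
  have hF : Function.Bijective F := by
    constructor
    · rintro ⟨e, v, hv⟩ ⟨f, w, hw⟩ h
      have h' := congrArg Subtype.val h
      simp only [F, Sym2.eq_iff, Sum.inl.injEq, Sum.inr.injEq, reduceCtorEq, and_false,
        or_false] at h'
      obtain ⟨rfl, rfl⟩ := h'
      rfl
    · rintro ⟨z, hz⟩
      induction z using Sym2.ind with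
      | _ x y =>
        rw [SimpleGraph.mem_edgeSet] at hz
        rcases x with v | e <;> rcases y with w | f
        · exact (H.leviGraph_not_adj_inl_inl _ _ hz).elim
        · exact ⟨⟨f, v, (H.leviGraph_adj_inl_inr _ _).1 hz⟩, rfl⟩
        · exact ⟨⟨e, w, (H.leviGraph_adj_inr_inl _ _).1 hz⟩, Subtype.ext Sym2.eq_swap⟩
        · exact (H.leviGraph_not_adj_inr_inr _ _ hz).elim
  rw [← Nat.card_congr (Equiv.ofBijective F hF), Nat.card_sigma]
  simp

variable (m n : ℕ)

theorem card_triple_type : Fintype.card (Triple n m) = n.choose 3 * m := by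
  simp [Triple]

theorem card_edgeSet_multiComplete :
    Nat.card (multiComplete m n).leviGraph.edgeSet = 3 * (n.choose 3 * m) := by
  rw [MultiHypergraph.card_edgeSet_leviGraph, ← card_triple_type]
  have : ∀ e : Triple n m, ((multiComplete m n).verts e).card = 3 := fun e => e.1.2
  simp [this, mul_comm]

theorem card_vert_multiComplete :
    Nat.card (Fin n ⊕ Triple n m) = n + n.choose 3 * m := by
  rw [Nat.card_sum, Nat.card_eq_fintype_card, Nat.card_eq_fintype_card, card_triple_type,
    Fintype.card_fin]

variable {m n}

theorem rot_ne_self (hm : 1 ≤ m) (hn : 4 ≤ n)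
    (Φ : EmbeddingScheme (multiComplete m n).leviGraph) (v) (x) : Φ.rot v x ≠ x := by
  refine (Φ.rot_cyclic v).apply_ne ?_ (Set.mem_univ x)
  rcases v with v | e
  · obtain ⟨a, b, c, ha, hb, hc, hab, hac, hbc⟩ :
        ∃ a b c, v ≠ a ∧ v ≠ b ∧ v ≠ c ∧ a ≠ b ∧ a ≠ c ∧ b ≠ c := by
      have h1 : 2 < (Finset.univ.erase v).card := by
        rw [Finset.card_erase_of_mem (Finset.mem_univ v), Finset.card_univ, Fintype.card_fin]
        omega
      obtain ⟨a, ha, b, hb, c, hc, h⟩ := Finset.two_lt_card.1 h1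
      exact ⟨a, b, c, (Finset.ne_of_mem_erase ha).symm, (Finset.ne_of_mem_erase hb).symm,
        (Finset.ne_of_mem_erase hc).symm, h⟩
    let e : Triple n m := (⟨{v, a, b}, card_triple ha hb hab⟩, ⟨0, hm⟩)
    let f : Triple n m := (⟨{v, a, c}, card_triple ha hc hac⟩, ⟨0, hm⟩)
    have hef : e ≠ f := by
      intro h
      have h1 : b ∈ f.1.1 := by rw [← h]; simp [e]
      simp only [f, Finset.mem_insert, Finset.mem_singleton] at h1
      exact h1.elim hb.symm fun h1 => h1.elim hab.symm hbc
    refine ⟨⟨Sum.inr e, ?_⟩, trivial, ⟨Sum.inr f, ?_⟩, trivial, ?_⟩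
    · exact ((multiComplete m n).leviGraph_adj_inl_inr v e).2 (by simp [multiComplete, e])
    · exact ((multiComplete m n).leviGraph_adj_inl_inr v f).2 (by simp [multiComplete, f])
    · intro h
      exact hef (Sum.inr_injective (congrArg Subtype.val h))
  · obtain ⟨a, b, ha, hb, hab⟩ := Finset.one_lt_card_iff.1 (by rw [e.1.2]; omega : 1 < e.1.1.card)
    refine ⟨⟨Sum.inl a, ?_⟩, trivial, ⟨Sum.inl b, ?_⟩, trivial, ?_⟩
    · exact ((multiComplete m n).leviGraph_adj_inr_inl a e).2 ha
    · exact ((multiComplete m n).leviGraph_adj_inr_inl b e).2 hb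
    · intro h
      exact hab (Sum.inl_injective (congrArg Subtype.val h))

theorem eulerChar_le (hm : 1 ≤ m) (hn : 4 ≤ n)
    (Φ : EmbeddingScheme (multiComplete m n).leviGraph) :
    2 * Φ.eulerChar ≤ 2 * n - n.choose 3 * m := by
  have h := Φ.card_face_le (fun x => x.isLeft) (by
    rintro (a | a) (b | b) hab
    · exact ((multiComplete m n).leviGraph_not_adj_inl_inl _ _ hab).elim
    · simp
    · simp
    · exact ((multiComplete m n).leviGraph_not_adj_inr_inr _ _ hab).elim) (rot_ne_self hm hn Φ)
  unfold EmbeddingScheme.eulerChar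
  rw [card_edgeSet_multiComplete] at h ⊢
  rw [card_vert_multiComplete]
  push_cast
  zify at h
  linarith

theorem eulerChar_of_quad (hm : 1 ≤ m) (hn : 4 ≤ n)
    (Φ : EmbeddingScheme (multiComplete m n).leviGraph) (hΦ : ∀ t, Φ.Quad t) :
    2 * Φ.eulerChar = 2 * n - n.choose 3 * m := by
  refine le_antisymm (eulerChar_le hm hn Φ) ?_
  have h := Φ.le_card_face hΦ
  unfold EmbeddingScheme.eulerChar
  rw [card_edgeSet_multiComplete] at h ⊢
  rw [card_vert_multiComplete]
  push_cast
  zify at h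
  linarith

/-- Divisibility by four makes the extremal Euler characteristic an even integer, and `N ≤ D + 1`
makes the genus non-negative. -/
theorem exists_choose_three_eq (N : ℕ) (hN : 2 ≤ N) :
    ∃ D : ℕ, (2 * N).choose 3 = 4 * D ∧ 6 * D = N * (N - 1) * (2 * N - 1) ∧ N ≤ D + 1 := by
  obtain ⟨M, rfl⟩ : ∃ M, N = M + 2 := ⟨N - 2, by omega⟩
  have h1 : 6 * (2 * (M + 2)).choose 3 = (2 * (M + 2)) * (2 * M + 3) * (2 * M + 2) := by
    have h := Nat.descFactorial_eq_factorial_mul_choose (2 * (M + 2)) 3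
    simp only [Nat.descFactorial, Nat.factorial] at h
    have e1 : 2 * (M + 2) - 2 = 2 * M + 2 := by omega
    have e2 : 2 * (M + 2) - 1 = 2 * M + 3 := by omega
    rw [e1, e2] at h
    simp only [Nat.sub_zero, Nat.succ_eq_add_one] at h
    linarith
  have h2 : Even ((M + 2) * (M + 1)) := by
    rw [mul_comm]
    exact Nat.even_mul_succ_self (M + 1)
  obtain ⟨p, hp⟩ := h2
  have h3 : 6 * (2 * (M + 2)).choose 3 = 8 * (p * (2 * M + 3)) := by
    rw [h1]
    linear_combination 4 * (2 * M + 3) * hp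
  obtain ⟨D, hD⟩ : 4 ∣ (2 * (M + 2)).choose 3 := by omega
  have e1 : M + 2 - 1 = M + 1 := by omega
  have e2 : 2 * (M + 2) - 1 = 2 * M + 3 := by omega
  have h4 : 6 * D = (M + 2) * (M + 1) * (2 * M + 3) := by
    have : 24 * D = 4 * ((M + 2) * (M + 1) * (2 * M + 3)) := by
      rw [hp]
      rw [hD] at h3
      linarith
    omega
  refine ⟨D, hD, by rw [e1, e2, h4], ?_⟩
  nlinarith

end Count

end HypergraphGenus

theorem theorem1p4 (m n : ℕ) (hm : 1 ≤ m) (hn : 4 ≤ n) (hne : Even n) :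
    (∃ g : ℕ, (HypergraphGenus.multiComplete m n).genus = (g : ℕ∞) ∧
      (g : ℚ) = ((n : ℚ) - 2) * ((m : ℚ) * n * ((n : ℚ) - 1) - 12) / 24) ∧
    (∃ c : ℕ, (HypergraphGenus.multiComplete m n).nonorientableGenus = (c : ℕ∞) ∧
      (c : ℚ) = ((n : ℚ) - 2) * ((m : ℚ) * n * ((n : ℚ) - 1) - 12) / 12) := by
  open HypergraphGenus in
  obtain ⟨N, rfl⟩ := hne.two_dvd
  have hN : 2 ≤ N := by omega
  obtain ⟨D, hD, hD6, hDN⟩ := exists_choose_three_eq N hN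
  have hDm : N ≤ m * D + 1 := by nlinarith
  obtain ⟨g, hg⟩ : ∃ g, g + N = m * D + 1 := ⟨m * D + 1 - N, by omega⟩
  have hgZ : (g : ℤ) = m * D + 1 - N := by
    have : (g : ℤ) + N = m * D + 1 := by exact_mod_cast hg
    linarith
  have hgQ : (g : ℚ) = ((2 * N : ℕ) - 2 : ℚ) *
      ((m : ℚ) * (2 * N : ℕ) * (((2 * N : ℕ) : ℚ) - 1) - 12) / 24 := by
    have h1 : (6 : ℚ) * D = N * (N - 1) * (2 * N - 1) := by
      have : ((6 * D : ℕ) : ℚ) = (N * (N - 1) * (2 * N - 1) : ℕ) := by rw [hD6]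
      rw [Nat.cast_mul, Nat.cast_mul, Nat.cast_mul, Nat.cast_sub (by omega),
        Nat.cast_sub (by omega)] at this
      push_cast at this
      exact this
    have h2 : (g : ℚ) = m * D + 1 - N := by exact_mod_cast congrArg (Int.cast : ℤ → ℚ) hgZ
    rw [h2]
    push_cast
    linear_combination (m : ℚ) / 6 * h1
  have hle : ∀ Φ : EmbeddingScheme (multiComplete m (2 * N)).leviGraph,
      Φ.eulerChar ≤ 2 - 2 * g := by
    intro Φ
    have h := eulerChar_le hm hn Φ
    rw [hD] at h
    push_cast at h
    linarith
  have hquad : ∀ Φ : EmbeddingScheme (multiComplete m (2 * N)).leviGraph, (∀ t, Φ.Quad t) →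
      Φ.eulerChar = 2 - 2 * g := by
    intro Φ hΦ
    have h := eulerChar_of_quad hm hn Φ hΦ
    rw [hD] at h
    push_cast at h
    linarith
  let q : Fin (2 * N) ≃ Fin N × Bool := Fintype.equivOfCardEq (by simp [mul_comm])
  have hor : EmbedsInOrientable (multiComplete m (2 * N)).leviGraph g := by
    obtain ⟨Φ, h1, h2⟩ := exists_orientable_quad (m := m) q
    exact ⟨Φ, h1, hquad Φ h2⟩
  have hlow : ∀ h, EmbedsInOrientable (multiComplete m (2 * N)).leviGraph h → g ≤ h := by
    rintro h ⟨Φ, -, h2⟩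
    have := hle Φ
    omega
  refine ⟨⟨g, ?_, hgQ⟩, ⟨2 * g, ?_, ?_⟩⟩
  · refine le_antisymm (iInf₂_le g hor) (le_iInf₂ fun h hh => ?_)
    exact_mod_cast hlow h hh
  · unfold MultiHypergraph.nonorientableGenus graphNonorientableGenus
    split_ifs with h0
    · have := hlow 0 h0
      obtain rfl : g = 0 := by omega
      rfl
    · have hcase : 2 ≤ m ∨ 3 ≤ N := by
        by_contra! hc
        obtain rfl : m = 1 := by omega
        obtain rfl : N = 2 := by omega
        have : g = 0 := by omega
        exact h0 (this ▸ hor)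
      have hnon : EmbedsInNonorientable (multiComplete m (2 * N)).leviGraph (2 * g) := by
        obtain ⟨Φ, h1, h2⟩ := exists_nonorientable_quad q hN hm hcase
        refine ⟨Φ, h1, ?_⟩
        rw [hquad Φ h2]
        push_cast
        ring
      refine le_antisymm (iInf₂_le (2 * g) hnon) (le_iInf₂ fun c hc => ?_)
      obtain ⟨Φ, -, h2⟩ := hc
      have := hle Φ
      have h3 : 2 * g ≤ c := by omega
      exact_mod_cast h3
  · push_cast at hgQ ⊢
    rw [hgQ]
    ring
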